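/- Let $\Bbbk$ be a field. For a class $\mathcal C$ of functions $U\to V$ between finite sets, let $S=\Bbbk[x_{u,v} : (u,v)\in U\times V]$ with its $\mathbb N^{U\times V}$-grading, let $\mathcal S_{\mathcal C}$ be the simplicial complex on $U\times V$ whose faces are the subsets of graphs of members of $\mathcal C$, and let the canonical ideal $I^\star_{\mathcal C}\subseteq S$ be the squarefree Alexander dual of the Stanley--Reisner ideal of $\mathcal S_{\mathcal C}$. For a partial function $g$ from $U$ to $V$, write $\beta_{i,g}(\mathcal C)$ for the $i$th graded Betti number of $I^\star_{\mathcal C}$ in the squarefree degree $\Gamma g=(U\times V)\setminus\operatorname{graph}(g)$, that is, the number of summands $S(-\Gamma g)$ in homological degree $i$ of a minimal $\mathbb N^{U\times V}$-graded free resolution of $I^\star_{\mathcal C}$. The homological dimension of $\mathcal C$ is the length of a minimal graded free resolution of $I^\star_{\mathcal C}$. Let $\dagger$ be the partial function with empty domain. Let $\mathrm{POLYTHR}_d^k$ be the class of functions $\{-1,1\}^d\to\{-1,1\}$ of the form $u\mapsto\operatorname{sgn} p(u)$, where $p$ is a real polynomial in $d$ variables of total degree at most $k$ which does not vanish at any point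 of $\{-1,1\}^d$, and let $\mathrm{parity}_d(u)=u_0u_1\cdots u_{d-1}$. Theorem. Let $k<d$ be natural numbers and let $e=\sum_{j=0}^k\binom dj$. Then 1. $\beta_{i,\dagger}(\mathrm{POLYTHR}_d^k\cup\{\mathrm{parity}_d\})=0$ for all $i\ge 0$; 2. $\beta_{e,\dagger}(\mathrm{POLYTHR}_d^k)=1$, and $e$ is the homological dimension of $\mathrm{POLYTHR}_d^k$; 3. consequently (Minsky--Papert) $\mathrm{parity}_d\notin\mathrm{POLYTHR}_d^k$. -/

import Mathlib

open MvPolynomial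

noncomputable section

/-- The squarefree exponent vector of a finite set of variables. -/
def squarefreeExp {σ : Type*} (s : Finset σ) : σ →₀ ℕ :=
  ∑ i ∈ s, Finsupp.single i 1

/-- The Stanley-Reisner ideal of a simplicial complex `Δ` on the vertex set `σ`: it is generated by
the squarefree monomials of the nonfaces. A simplicial complex is a family of finite sets closed
under passing to subsets; it may be void, and if it is not void then it contains the empty face. -/
def stanleyReisnerIdeal (𝕜 : Type*) [Field 𝕜] {σ : Type*} (Δ : LowerSet (Finset σ)) :
    Ideal (MvPolynomial σ 𝕜) :=
  Ideal.span {p | ∃ s : Finset σ, s ∉ Δ ∧ p = monomial (squarefreeExp s) 1}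

/-- The squarefree Alexander dual of a squarefree monomial ideal `I`: the intersection of the
ideals `⟨x_i : i ∈ s⟩`, where `x^s` runs over the squarefree monomials of `I` (these generate
`I`; by monotonicity any other set of squarefree monomial generators gives the same ideal). -/
def alexanderDual {𝕜 : Type*} [Field 𝕜] {σ : Type*} (I : Ideal (MvPolynomial σ 𝕜)) :
    Ideal (MvPolynomial σ 𝕜) :=
  ⨅ s ∈ {s : Finset σ | monomial (squarefreeExp s) (1 : 𝕜) ∈ I},
    Ideal.span ((fun i => (X i : MvPolynomial σ 𝕜)) '' (s : Set σ))

/-- A minimal `ℕ^σ`-graded free resolution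
`0 ← I ← F 0 ← F 1 ← F 2 ← ⋯` of an ideal `I` of the polynomial ring `S = 𝕜[x_i : i ∈ σ]`.
The module `F i` is free of finite rank `rank i`, and its basis vector `b` has degree `deg i b`,
so that `F i = ⨁ b, S(-deg i b)`. -/
structure MinimalGradedFreeResolution {𝕜 : Type*} [Field 𝕜] {σ : Type*}
    (I : Ideal (MvPolynomial σ 𝕜)) where
  /-- the rank of the free module in homological degree `i` -/
  rank : ℕ → ℕ
  /-- the degrees of the basis vectors -/
  deg : ∀ i, Fin (rank i) → (σ →₀ ℕ)
  /-- the differential `F (i + 1) → F i` -/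
  diff : ∀ i, (Fin (rank (i + 1)) → MvPolynomial σ 𝕜) →ₗ[MvPolynomial σ 𝕜]
    (Fin (rank i) → MvPolynomial σ 𝕜)
  /-- the augmentation `F 0 → I ⊆ S` -/
  aug : (Fin (rank 0) → MvPolynomial σ 𝕜) →ₗ[MvPolynomial σ 𝕜] MvPolynomial σ 𝕜
  /-- the differentials preserve the multidegree -/
  diff_graded : ∀ i (b : Fin (rank (i + 1))) (c : Fin (rank i)),
    ∀ m ∈ (diff i (Pi.single b 1) c).support, m + deg i c = deg (i + 1) b
  /-- the augmentation preserves the multidegree -/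
  aug_graded : ∀ (b : Fin (rank 0)), ∀ m ∈ (aug (Pi.single b 1)).support, m = deg 0 b
  range_aug : LinearMap.range aug = I
  exact_zero : LinearMap.ker aug = LinearMap.range (diff 0)
  exact_succ : ∀ i, LinearMap.ker (diff i) = LinearMap.range (diff (i + 1))
  /-- minimality: the image of `F (i + 1)` lies in `⟨x_j : j ∈ σ⟩ F i` -/
  minimal : ∀ i x c, constantCoeff (diff i x c) = 0

/-- The number of summands `S(-a)` in homological degree `i`. -/
def MinimalGradedFreeResolution.multiplicity {𝕜 : Type*} [Field 𝕜] {σ : Type*}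
    {I : Ideal (MvPolynomial σ 𝕜)} (F : MinimalGradedFreeResolution I)
    (i : ℕ) (a : σ →₀ ℕ) : ℕ :=
  Nat.card {b : Fin (F.rank i) // F.deg i b = a}

/-- The `i`th Betti number of the ideal `I` in degree `a` is `n`: `I` has a minimal graded free
resolution, and in each of them `S(-a)` occurs `n` times in homological degree `i`. -/
def HasBettiNumber {𝕜 : Type*} [Field 𝕜] {σ : Type*} (I : Ideal (MvPolynomial σ 𝕜))
    (i : ℕ) (a : σ →₀ ℕ) (n : ℕ) : Prop :=
  Nonempty (MinimalGradedFreeResolution I) ∧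
    ∀ F : MinimalGradedFreeResolution I, F.multiplicity i a = n

/-- The projective dimension of the ideal `I` is `e`: `I` has a minimal graded free resolution,
and each of them has length `e`, i.e. `e` is the greatest homological degree of a nonzero module
in the resolution. -/
def HasProjectiveDim {𝕜 : Type*} [Field 𝕜] {σ : Type*} (I : Ideal (MvPolynomial σ 𝕜))
    (e : ℕ) : Prop :=
  Nonempty (MinimalGradedFreeResolution I) ∧
    ∀ F : MinimalGradedFreeResolution I, IsGreatest {i | F.rank i ≠ 0} e

/-- The canonical suboplex of a class `C` of functions `U → V`: the simplicial complex on `U × V`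
whose faces are the subsets of the graphs of the members of `C`. -/
def canonicalSuboplex {U V : Type*} (C : Set (U → V)) : LowerSet (Finset (U × V)) where
  carrier := {s | ∃ f ∈ C, ∀ p ∈ s, f p.1 = p.2}
  lower' := fun _ _ hts ⟨f, hf, h⟩ => ⟨f, hf, fun p hp => h p (hts hp)⟩

/-- The canonical ideal of a class: the Alexander dual of the Stanley-Reisner ideal of its
canonical suboplex. -/
def canonicalIdeal (𝕜 : Type*) [Field 𝕜] {U V : Type*} (C : Set (U → V)) :
    Ideal (MvPolynomial (U × V) 𝕜) :=
  alexanderDual (stanleyReisnerIdeal 𝕜 (canonicalSuboplex C))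

open Classical in
/-- `Γ g`: the exponent vector of the complement in `U × V` of the graph of a partial function. -/
def gammaExp {U V : Type*} [Fintype U] [Fintype V] (g : U →. V) : U × V →₀ ℕ :=
  squarefreeExp (Finset.univ.filter fun p => p ∉ g.graph)

/-- The partial function with empty domain. -/
def emptyPFun (U V : Type*) : U →. V := fun _ => Part.none

/-- `β_{i, g}(C) = n`: the `i`th Betti number of the class `C` at the partial function `g`, which
is the Betti number of the canonical ideal of `C` in degree `Γ g`. -/
def HasClassBettiNumber (𝕜 : Type*) [Field 𝕜] {U V : Type*} [Fintype U] [Fintype V]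
    (C : Set (U → V)) (i : ℕ) (g : U →. V) (n : ℕ) : Prop :=
  HasBettiNumber (canonicalIdeal 𝕜 C) i (gammaExp g) n

/-- The homological dimension of the class `C` is `e`. -/
def HasHomologicalDim (𝕜 : Type*) [Field 𝕜] {U V : Type*} (C : Set (U → V)) (e : ℕ) : Prop :=
  HasProjectiveDim (canonicalIdeal 𝕜 C) e

/-- The polynomial threshold functions of degree at most `k` on `d` bits, where a bit is an element
of `{1, -1} = ℤˣ`: the signs of the real polynomials of degree at most `k` that do not vanish at
any point of the cube (the sign of `0` is `0`, hence not a value of `f`). -/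
def polythr (d k : ℕ) : Set ((Fin d → ℤˣ) → ℤˣ) :=
  {f | ∃ p : MvPolynomial (Fin d) ℝ, p.totalDegree ≤ k ∧
    ∀ u, (((f u : ℤˣ) : ℤ) : ℝ) = Real.sign (eval (fun i => (((u i : ℤˣ) : ℤ) : ℝ)) p)}

/-- The parity function on `d` bits, in the `{1, -1}` encoding. -/
def parity (d : ℕ) : (Fin d → ℤˣ) → ℤˣ := fun u => ∏ i, u i

end

/-! Let `M` be the space of functions on the cube given by polynomials of degree at most `k`. The
Walsh characters of sets of at most `k` coordinates form a basis, so `dim M = e`. A set of vertices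
`(u, v)` is a face of the suboplex `Δ` of the threshold class exactly when the open half-spaces `v *
p u > 0` of `M` have a common point. Thus `Δ` is the nerve of a cover of `M \ {0}` by convex sets, a
homology sphere of dimension `e - 1`. By Hochster's formula the Betti number at `†` in degree `i` is
the dimension of the reduced homology of `Δ` in degree `i - 1`: it is one for `i = e`. Links give
the other squarefree degrees, and nothing survives above `e`.

Adding parity glues in the simplex `P` on its graph. Parity is orthogonal to `M`. Hence no `p` in
`M` can have the sign opposite to parity on a nonempty set of points and vanish at all others, since
the sum of `parity * p` would be negative. So every nonempty set of vertices outside `P` has acyclic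
link, and attaching these vertices to the simplex `P` one by one creates no homology. The same
orthogonality gives the Minsky–Papert statement directly.

Neither Hochster's formula nor the nerve theorem is quoted. Homology is read off from an arbitrary
minimal resolution `F`: for a degree `a` and a set `L` of variables, take the basis elements of `F`
with degree in `box a L`. For `L = ∅` this is the degree `a` part of `F`, a resolution of `I_a`. For
`L` everything, only basis elements of degree exactly `a` remain; minimality kills the differential,
and they count the Betti number. Adding `j` to `L` is passing to the quotient by the strand of `a -
e_j`, whence a long exact sequence. When `a` is the indicator of `tᶜ`, the strand has the homology
of the complex of sets `s ⊆ L` with `t ∪ s ∈ Δ`. The nerve theorem is replaced by inductions over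
the points of the cube: `faceAcyclic_signPairs_aux`, `faceDimOne_signPairs`,
`faceExactAt_signPairs`. Parity is handled by `faceAcyclic_univ_of_orthogonal`. -/

noncomputable section

/-! ### Strands of poset-graded complexes and their long exact sequences. -/

/-- A complex of finite-dimensional vector spaces with bases graded by a poset `P`, whose
differentials are triangular with respect to the grading. -/
structure ScalarComplex (𝕜 : Type*) [Field 𝕜] (P : Type*) [PartialOrder P] where
  rank : ℕ → ℕ
  deg : ∀ i, Fin (rank i) → P
  d : ∀ i, (Fin (rank (i + 1)) → 𝕜) →ₗ[𝕜] (Fin (rank i) → 𝕜)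
  d_d : ∀ i v, d i (d (i + 1) v) = 0
  d_le : ∀ i b c, d i (Pi.single b 1) c ≠ 0 → deg i c ≤ deg (i + 1) b

namespace ScalarComplex

variable {𝕜 : Type*} [Field 𝕜] {P : Type*} [PartialOrder P] (K : ScalarComplex 𝕜 P)

/-- The chains supported in degrees belonging to `Q`. -/
def chains (Q : Set P) (i : ℕ) : Submodule 𝕜 (Fin (K.rank i) → 𝕜) where
  carrier := {v | ∀ b, K.deg i b ∉ Q → v b = 0}
  add_mem' := fun hv hw b hb => by simp [hv b hb, hw b hb]
  zero_mem' := fun _ _ => rfl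
  smul_mem' := fun c v hv b hb => by simp [hv b hb]

open Classical in
/-- The coordinate projection onto the chains supported in degrees belonging to `Q`. -/
def proj (Q : Set P) (i : ℕ) : (Fin (K.rank i) → 𝕜) →ₗ[𝕜] (Fin (K.rank i) → 𝕜) :=
  LinearMap.pi fun b => if K.deg i b ∈ Q then LinearMap.proj b else 0

variable {K} {Q Q' : Set P} {i : ℕ}

lemma proj_apply_mem (v : Fin (K.rank i) → 𝕜) {b : Fin (K.rank i)} (hb : K.deg i b ∈ Q) :
    K.proj Q i v b = v b := by
  simp [proj, hb]

lemma proj_apply_notMem (v : Fin (K.rank i) → 𝕜) {b : Fin (K.rank i)} (hb : K.deg i b ∉ Q) :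
    K.proj Q i v b = 0 := by
  simp [proj, hb]

lemma proj_mem (v : Fin (K.rank i) → 𝕜) : K.proj Q i v ∈ K.chains Q i :=
  fun _ hb => proj_apply_notMem v hb

lemma proj_eq_self {v : Fin (K.rank i) → 𝕜} (hv : v ∈ K.chains Q i) : K.proj Q i v = v := by
  funext b
  by_cases hb : K.deg i b ∈ Q
  · exact proj_apply_mem v hb
  · rw [proj_apply_notMem v hb, hv b hb]

lemma chains_mono (h : Q' ⊆ Q) : K.chains Q' i ≤ K.chains Q i :=
  fun _ hv b hb => hv b fun hb' => hb (h hb')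

lemma proj_diff_proj (v : Fin (K.rank i) → 𝕜) :
    K.proj (Q \ Q') i (K.proj Q i v) = K.proj (Q \ Q') i v := by
  funext b
  by_cases hb : K.deg i b ∈ Q \ Q'
  · rw [proj_apply_mem _ hb, proj_apply_mem _ hb, proj_apply_mem _ hb.1]
  · rw [proj_apply_notMem _ hb, proj_apply_notMem _ hb]

lemma proj_diff_eq_zero {v : Fin (K.rank i) → 𝕜} (hv : v ∈ K.chains Q' i) :
    K.proj (Q \ Q') i v = 0 := by
  funext b
  by_cases hb : K.deg i b ∈ Q \ Q'
  · rw [proj_apply_mem _ hb, hv b hb.2, Pi.zero_apply]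
  · rw [proj_apply_notMem _ hb, Pi.zero_apply]

lemma mem_chains_of_proj_diff {v : Fin (K.rank i) → 𝕜} (hv : v ∈ K.chains Q i)
    (h : K.proj (Q \ Q') i v = 0) : v ∈ K.chains Q' i := by
  intro b hb
  by_cases hQ : K.deg i b ∈ Q
  · rw [← proj_apply_mem (Q := Q \ Q') v ⟨hQ, hb⟩, h, Pi.zero_apply]
  · exact hv b hQ

lemma sub_proj_diff_mem {v : Fin (K.rank i) → 𝕜} (hv : v ∈ K.chains Q i) :
    v - K.proj (Q \ Q') i v ∈ K.chains Q' i := by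
  intro b hb
  by_cases hQ : K.deg i b ∈ Q
  · rw [Pi.sub_apply, proj_apply_mem (Q := Q \ Q') _ ⟨hQ, hb⟩, sub_self]
  · rw [Pi.sub_apply, proj_apply_notMem _ fun h => hQ h.1, hv b hQ, sub_self]

lemma d_apply_eq_zero (v : Fin (K.rank (i + 1)) → 𝕜) (c : Fin (K.rank i))
    (h : ∀ b, K.deg i c ≤ K.deg (i + 1) b → v b = 0) : K.d i v c = 0 := by
  have hv : v = ∑ b, v b • (Pi.single b 1 : Fin (K.rank (i + 1)) → 𝕜) := by
    funext b
    simp [Finset.sum_apply, Pi.single_apply]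
  rw [hv, map_sum, Finset.sum_apply]
  refine Finset.sum_eq_zero fun b _ => ?_
  rw [map_smul, Pi.smul_apply, smul_eq_mul]
  by_cases hb : K.d i (Pi.single b 1) c = 0
  · rw [hb, mul_zero]
  · rw [h b (K.d_le i b c hb), zero_mul]

variable (K) in
/-- The differential of the strand of the complex in the degrees belonging to `Q`. -/
def strand (Q : Set P) (i : ℕ) : (Fin (K.rank (i + 1)) → 𝕜) →ₗ[𝕜] (Fin (K.rank i) → 𝕜) :=
  K.proj Q i ∘ₗ K.d i

lemma strand_mem (v : Fin (K.rank (i + 1)) → 𝕜) : K.strand Q i v ∈ K.chains Q i :=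
  proj_mem _

/-- The terms of `d v` discarded by the projection have degrees outside `Q`. Such a degree cannot
lie between two degrees of `Q`, so these terms cannot contribute to the boundary inside `Q`. -/
lemma strand_strand (hQ : Q.OrdConnected) {v : Fin (K.rank (i + 1 + 1)) → 𝕜}
    (hv : v ∈ K.chains Q (i + 1 + 1)) : K.strand Q i (K.strand Q (i + 1) v) = 0 := by
  have h : K.strand Q i (K.strand Q (i + 1) v)
      = - K.proj Q i (K.d i (K.d (i + 1) v - K.strand Q (i + 1) v)) := by
    simp [strand, K.d_d]
  rw [h, neg_eq_zero]
  funext c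
  by_cases hc : K.deg i c ∈ Q
  · rw [proj_apply_mem _ hc, Pi.zero_apply]
    refine d_apply_eq_zero _ _ fun b hcb => ?_
    by_cases hb : K.deg (i + 1) b ∈ Q
    · simp [strand, proj_apply_mem _ hb]
    · rw [Pi.sub_apply, strand, LinearMap.comp_apply, proj_apply_notMem _ hb, sub_zero]
      refine d_apply_eq_zero _ _ fun a hba => hv a fun ha => hb (hQ.out hc ha ⟨hcb, hba⟩)
  · rw [proj_apply_notMem _ hc, Pi.zero_apply]

/-- `Q'` is a down-closed part of `Q`. -/
def IsLowerIn (Q' Q : Set P) : Prop :=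
  Q' ⊆ Q ∧ ∀ x ∈ Q', ∀ y ∈ Q, y ≤ x → y ∈ Q'

/-- Differentials only lower degrees, so a down-closed part spans a subcomplex; the complement `Q \
Q'` then carries the quotient complex. -/
lemma strand_eq_of_lower (h : IsLowerIn Q' Q) {v : Fin (K.rank (i + 1)) → 𝕜}
    (hv : v ∈ K.chains Q' (i + 1)) : K.strand Q i v = K.strand Q' i v := by
  funext c
  by_cases hc' : K.deg i c ∈ Q'
  · simp only [strand, LinearMap.comp_apply]
    rw [proj_apply_mem _ hc', proj_apply_mem _ (h.1 hc')]
  · simp only [strand, LinearMap.comp_apply]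
    rw [proj_apply_notMem _ hc']
    by_cases hc : K.deg i c ∈ Q
    · rw [proj_apply_mem _ hc]
      exact d_apply_eq_zero _ _ fun b hb => hv b fun hb' => hc' (h.2 _ hb' _ hc hb)
    · rw [proj_apply_notMem _ hc]

lemma proj_diff_strand (v : Fin (K.rank (i + 1)) → 𝕜) :
    K.proj (Q \ Q') i (K.strand Q i v) = K.strand (Q \ Q') i v :=
  proj_diff_proj _

lemma strand_diff_proj (h : IsLowerIn Q' Q) {v : Fin (K.rank (i + 1)) → 𝕜}
    (hv : v ∈ K.chains Q (i + 1)) :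
    K.strand (Q \ Q') i (K.proj (Q \ Q') (i + 1) v) = K.strand (Q \ Q') i v := by
  have h1 := sub_proj_diff_mem (Q' := Q') hv
  have h2 : K.strand (Q \ Q') i (v - K.proj (Q \ Q') (i + 1) v) = 0 := by
    rw [← proj_diff_strand, strand_eq_of_lower h h1]
    exact proj_diff_eq_zero (strand_mem _)
  rw [map_sub, sub_eq_zero] at h2
  exact h2.symm

variable (K) in
/-- The strand in the degrees belonging to `Q` is exact at the index `i + 1`. -/
def ExactAt (Q : Set P) (i : ℕ) : Prop :=
  ∀ v ∈ K.chains Q (i + 1), K.strand Q i v = 0 →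
    ∃ w ∈ K.chains Q (i + 1 + 1), K.strand Q (i + 1) w = v

variable (K) in
/-- The homology of the strand in the degrees belonging to `Q` is one-dimensional at the
index `i + 1`. -/
def HomologyDimOne (Q : Set P) (i : ℕ) : Prop :=
  ∃ z ∈ K.chains Q (i + 1), K.strand Q i z = 0 ∧
    (∀ w ∈ K.chains Q (i + 1 + 1), K.strand Q (i + 1) w ≠ z) ∧
    ∀ v ∈ K.chains Q (i + 1), K.strand Q i v = 0 →
      ∃ c : 𝕜, ∃ w ∈ K.chains Q (i + 1 + 1), K.strand Q (i + 1) w = v - c • z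

lemma ExactAt.of_lower_of_diff (hQ : Q.OrdConnected) (h : IsLowerIn Q' Q)
    (h' : K.ExactAt Q' i) (h'' : K.ExactAt (Q \ Q') i) : K.ExactAt Q i := by
  intro v hv hdv
  obtain ⟨w, hw, hwv⟩ := h'' (K.proj (Q \ Q') _ v) (proj_mem _) (by
    rw [strand_diff_proj h hv, ← proj_diff_strand, hdv, map_zero])
  have hwQ := chains_mono Set.sdiff_subset hw
  have hu : v - K.strand Q (i + 1) w ∈ K.chains Q' (i + 1) := by
    refine mem_chains_of_proj_diff (sub_mem hv (strand_mem _)) ?_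
    rw [map_sub, proj_diff_strand, hwv, sub_self]
  obtain ⟨y, hy, hyu⟩ := h' _ hu (by
    rw [← strand_eq_of_lower h hu, map_sub, hdv, strand_strand hQ hwQ, sub_zero])
  refine ⟨y + w, add_mem (chains_mono h.1 hy) hwQ, ?_⟩
  rw [map_add, strand_eq_of_lower h hy, hyu, sub_add_cancel]

/-- The connecting homomorphism: a lift of the boundary of a relative cycle. -/
lemma strand_mem_lower (hQ : Q.OrdConnected) (h : IsLowerIn Q' Q)
    {v : Fin (K.rank (i + 1 + 1)) → 𝕜} (hv : v ∈ K.chains (Q \ Q') (i + 1 + 1))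
    (hdv : K.strand (Q \ Q') (i + 1) v = 0) :
    K.strand Q (i + 1) v ∈ K.chains Q' (i + 1) ∧
      K.strand Q' i (K.strand Q (i + 1) v) = 0 := by
  have hmem : K.strand Q (i + 1) v ∈ K.chains Q' (i + 1) :=
    mem_chains_of_proj_diff (strand_mem _) (by rw [proj_diff_strand, hdv])
  refine ⟨hmem, ?_⟩
  rw [← strand_eq_of_lower h hmem, strand_strand hQ (chains_mono Set.sdiff_subset hv)]

/-- The piece of the long exact sequence that needs only injectivity of the homology of `Q'` into
that of `Q`. This form serves when both are nonzero, as in `exactAt_box_singleton`. -/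
lemma ExactAt.diff_of_lift (hQ : Q.OrdConnected) (h : IsLowerIn Q' Q)
    (h1 : K.ExactAt Q (i + 1))
    (h' : ∀ u ∈ K.chains Q' (i + 1), K.strand Q' i u = 0 →
      (∃ v ∈ K.chains Q (i + 1 + 1), K.strand Q (i + 1) v = u) →
      ∃ w ∈ K.chains Q' (i + 1 + 1), K.strand Q' (i + 1) w = u) :
    K.ExactAt (Q \ Q') (i + 1) := by
  intro v hv hdv
  have hvQ := chains_mono Set.sdiff_subset hv
  obtain ⟨hmem, hcyc⟩ := strand_mem_lower hQ h hv hdv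
  obtain ⟨w, hw, hwv⟩ := h' _ hmem hcyc ⟨v, hvQ, rfl⟩
  obtain ⟨y, hy, hyv⟩ := h1 (v - w) (sub_mem hvQ (chains_mono h.1 hw)) (by
    rw [map_sub, strand_eq_of_lower h hw, hwv, sub_self])
  refine ⟨K.proj (Q \ Q') _ y, proj_mem _, ?_⟩
  rw [strand_diff_proj h hy, ← proj_diff_strand, hyv, map_sub, proj_diff_eq_zero hw,
    proj_eq_self hv, sub_zero]

lemma ExactAt.diff (hQ : Q.OrdConnected) (h : IsLowerIn Q' Q)
    (h1 : K.ExactAt Q (i + 1)) (h' : K.ExactAt Q' i) : K.ExactAt (Q \ Q') (i + 1) :=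
  h1.diff_of_lift hQ h fun u hu hdu _ => h' u hu hdu

/-- Since `Q` has no homology at the two adjacent indices, the connecting map identifies the
homology of `Q \ Q'` with that of `Q'` one index lower. -/
lemma HomologyDimOne.diff_succ (hQ : Q.OrdConnected) (h : IsLowerIn Q' Q)
    (h0 : K.ExactAt Q i) (h1 : K.ExactAt Q (i + 1)) (h' : K.HomologyDimOne Q' i) :
    K.HomologyDimOne (Q \ Q') (i + 1) := by
  obtain ⟨z, hz, hdz, hnz, hspan⟩ := h'
  obtain ⟨w, hw, hwz⟩ := h0 z (chains_mono h.1 hz) (by rw [strand_eq_of_lower h hz, hdz])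
  have hwsub := sub_proj_diff_mem (Q' := Q') hw
  refine ⟨K.proj (Q \ Q') _ w, proj_mem _, ?_, ?_, ?_⟩
  · rw [strand_diff_proj h hw, ← proj_diff_strand, hwz, proj_diff_eq_zero hz]
  · intro y hy hyw
    have hyQ := chains_mono Set.sdiff_subset hy
    have hu : w - K.strand Q (i + 1 + 1) y ∈ K.chains Q' (i + 1 + 1) := by
      refine mem_chains_of_proj_diff (sub_mem hw (strand_mem _)) ?_
      rw [map_sub, proj_diff_strand, hyw, sub_self]
    refine hnz _ hu ?_
    rw [← strand_eq_of_lower h hu, map_sub, hwz, strand_strand hQ hyQ, sub_zero]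
  · intro v hv hdv
    obtain ⟨hmem, hcyc⟩ := strand_mem_lower hQ h hv hdv
    obtain ⟨c, y, hy, hyv⟩ := hspan _ hmem hcyc
    have hyQ := chains_mono h.1 hy
    have hvQ := chains_mono Set.sdiff_subset hv
    obtain ⟨x, hx, hxv⟩ := h1 (v - c • w - y)
      (sub_mem (sub_mem hvQ (Submodule.smul_mem _ c hw)) hyQ) (by
        rw [map_sub, map_sub, map_smul, hwz, strand_eq_of_lower h hy, hyv, sub_self])
    refine ⟨c, K.proj (Q \ Q') _ x, proj_mem _, ?_⟩
    rw [strand_diff_proj h hx, ← proj_diff_strand, hxv, map_sub, map_sub, map_smul,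
      proj_diff_eq_zero hy, proj_eq_self hv, sub_zero]

lemma HomologyDimOne.diff (hQ : Q.OrdConnected) (h : IsLowerIn Q' Q)
    (h0 : K.ExactAt Q' i) (h1 : K.ExactAt Q' (i + 1)) (hd : K.HomologyDimOne Q (i + 1)) :
    K.HomologyDimOne (Q \ Q') (i + 1) := by
  obtain ⟨z, hz, hdz, hnz, hspan⟩ := hd
  refine ⟨K.proj (Q \ Q') _ z, proj_mem _, ?_, ?_, ?_⟩
  · rw [strand_diff_proj h hz, ← proj_diff_strand, hdz, map_zero]
  · intro y hy hyz
    have hyQ := chains_mono Set.sdiff_subset hy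
    have hu : z - K.strand Q (i + 1 + 1) y ∈ K.chains Q' (i + 1 + 1) := by
      refine mem_chains_of_proj_diff (sub_mem hz (strand_mem _)) ?_
      rw [map_sub, proj_diff_strand, hyz, sub_self]
    obtain ⟨x, hx, hxu⟩ := h1 _ hu (by
      rw [← strand_eq_of_lower h hu, map_sub, hdz, strand_strand hQ hyQ, sub_zero])
    refine hnz (x + y) (add_mem (chains_mono h.1 hx) hyQ) ?_
    rw [map_add, strand_eq_of_lower h hx, hxu, sub_add_cancel]
  · intro v hv hdv
    obtain ⟨hmem, hcyc⟩ := strand_mem_lower hQ h hv hdv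
    obtain ⟨w, hw, hwv⟩ := h0 _ hmem hcyc
    have hwQ := chains_mono h.1 hw
    have hvQ := chains_mono Set.sdiff_subset hv
    obtain ⟨c, y, hy, hyv⟩ := hspan (v - w) (sub_mem hvQ hwQ) (by
      rw [map_sub, strand_eq_of_lower h hw, hwv, sub_self])
    refine ⟨c, K.proj (Q \ Q') _ y, proj_mem _, ?_⟩
    rw [strand_diff_proj h hy, ← proj_diff_strand, hyv, map_sub, map_sub, map_smul,
      proj_diff_eq_zero hw, proj_eq_self hv, sub_zero]

end ScalarComplex

/-! ### Homogeneous components of graded maps. -/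

section GradedFree

variable {𝕜 : Type*} [Field 𝕜] {σ : Type*}

open Classical in
/-- The coordinates of the component of degree `a` of an element of the graded free module
`⨁ b, S(-δ b)`. -/
def component {r : ℕ} (δ : Fin r → (σ →₀ ℕ)) (a : σ →₀ ℕ) :
    (Fin r → MvPolynomial σ 𝕜) →ₗ[𝕜] (Fin r → 𝕜) :=
  LinearMap.pi fun b => if δ b ≤ a then lcoeff 𝕜 (a - δ b) ∘ₗ LinearMap.proj b else 0

open Classical in
/-- The homogeneous element of degree `a` of the graded free module `⨁ b, S(-δ b)` with given
coordinates. -/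
def homogenize {r : ℕ} (δ : Fin r → (σ →₀ ℕ)) (a : σ →₀ ℕ) :
    (Fin r → 𝕜) →ₗ[𝕜] (Fin r → MvPolynomial σ 𝕜) :=
  LinearMap.pi fun b => if δ b ≤ a then monomial (a - δ b) ∘ₗ LinearMap.proj b else 0

/-- The property of an `S`-linear map of graded free modules of preserving the degree. -/
def IsGradedMap {r s : ℕ} (δ : Fin r → (σ →₀ ℕ)) (ε : Fin s → (σ →₀ ℕ))
    (f : (Fin r → MvPolynomial σ 𝕜) →ₗ[MvPolynomial σ 𝕜] (Fin s → MvPolynomial σ 𝕜)) : Prop :=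
  ∀ b c, ∀ m ∈ (f (Pi.single b 1) c).support, m + ε c = δ b

/-- The matrix of scalars of a degree-preserving map of graded free modules. -/
def scalarMatrix {r s : ℕ} (δ : Fin r → (σ →₀ ℕ)) (ε : Fin s → (σ →₀ ℕ))
    (f : (Fin r → MvPolynomial σ 𝕜) →ₗ[MvPolynomial σ 𝕜] (Fin s → MvPolynomial σ 𝕜)) :
    (Fin r → 𝕜) →ₗ[𝕜] (Fin s → 𝕜) :=
  LinearMap.pi fun c => ∑ b, coeff (δ b - ε c) (f (Pi.single b 1) c) • LinearMap.proj b

variable {r s t : ℕ} {δ : Fin r → (σ →₀ ℕ)} {ε : Fin s → (σ →₀ ℕ)} {η : Fin t → (σ →₀ ℕ)}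
  {f : (Fin r → MvPolynomial σ 𝕜) →ₗ[MvPolynomial σ 𝕜] (Fin s → MvPolynomial σ 𝕜)}
  {g : (Fin s → MvPolynomial σ 𝕜) →ₗ[MvPolynomial σ 𝕜] (Fin t → MvPolynomial σ 𝕜)}
  {a : σ →₀ ℕ}

lemma component_apply_of_le {b : Fin r} (h : δ b ≤ a) (y : Fin r → MvPolynomial σ 𝕜) :
    component δ a y b = coeff (a - δ b) (y b) := by
  simp [component, h]

lemma component_apply_of_not_le {b : Fin r} (h : ¬ δ b ≤ a) (y : Fin r → MvPolynomial σ 𝕜) :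
    component δ a y b = 0 := by
  simp [component, h]

lemma homogenize_apply_of_le {b : Fin r} (h : δ b ≤ a) (v : Fin r → 𝕜) :
    homogenize δ a v b = monomial (a - δ b) (v b) := by
  simp [homogenize, h]

lemma homogenize_apply_of_not_le {b : Fin r} (h : ¬ δ b ≤ a) (v : Fin r → 𝕜) :
    homogenize δ a v b = 0 := by
  simp [homogenize, h]

lemma component_homogenize {v : Fin r → 𝕜} (hv : ∀ b, ¬ δ b ≤ a → v b = 0) :
    component δ a (homogenize δ a v) = v := by
  funext b
  by_cases h : δ b ≤ a
  · rw [component_apply_of_le h, homogenize_apply_of_le h]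
    classical rw [coeff_monomial, if_pos rfl]
  · rw [component_apply_of_not_le h, hv b h]

lemma scalarMatrix_apply (v : Fin r → 𝕜) (c : Fin s) :
    scalarMatrix δ ε f v c = ∑ b, coeff (δ b - ε c) (f (Pi.single b 1) c) * v b := by
  simp [scalarMatrix]

lemma scalarMatrix_single (b : Fin r) (c : Fin s) :
    scalarMatrix δ ε f (Pi.single b 1) c = coeff (δ b - ε c) (f (Pi.single b 1) c) := by
  simp [scalarMatrix_apply, Pi.single_apply]

lemma IsGradedMap.le_of_coeff_ne_zero (hf : IsGradedMap δ ε f) {b : Fin r} {c : Fin s}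
    (h : coeff (δ b - ε c) (f (Pi.single b 1) c) ≠ 0) : ε c ≤ δ b := by
  rw [← hf b c _ (mem_support_iff.2 h)]
  exact le_add_self

lemma IsGradedMap.apply_single (hf : IsGradedMap δ ε f) (b : Fin r) (c : Fin s) :
    f (Pi.single b 1) c
      = monomial (δ b - ε c) (coeff (δ b - ε c) (f (Pi.single b 1) c)) := by
  classical
  ext m
  rw [coeff_monomial]
  split_ifs with h
  · rw [h]
  · by_contra hm
    refine h ?_
    rw [← hf b c m (mem_support_iff.2 hm), add_tsub_cancel_right]

lemma linearMap_apply_eq_sum (y : Fin r → MvPolynomial σ 𝕜) (c : Fin s) :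
    f y c = ∑ b, y b * f (Pi.single b 1) c := by
  conv_lhs => rw [pi_eq_sum_univ' y, map_sum, Finset.sum_apply]
  refine Finset.sum_congr rfl fun b _ => ?_
  rw [map_smul, Pi.smul_apply, smul_eq_mul]

/-- A graded map sends a basis vector to monomial multiples of basis vectors, so one scalar matrix,
independent of `a`, describes it in every degree. -/
lemma IsGradedMap.component_apply (hf : IsGradedMap δ ε f) (y : Fin r → MvPolynomial σ 𝕜) :
    component ε a (f y) = scalarMatrix δ ε f (component δ a y) := by
  classical
  funext c
  rw [scalarMatrix_apply]
  by_cases hc : ε c ≤ a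
  · rw [component_apply_of_le hc, linearMap_apply_eq_sum, coeff_sum]
    refine Finset.sum_congr rfl fun b _ => ?_
    rw [hf.apply_single, coeff_mul_monomial', coeff_monomial, if_pos rfl]
    by_cases h0 : coeff (δ b - ε c) (f (Pi.single b 1) c) = 0
    · simp [h0]
    have hcb := hf.le_of_coeff_ne_zero h0
    by_cases hb : δ b ≤ a
    · rw [if_pos (tsub_le_tsub_right hb _), component_apply_of_le hb, mul_comm,
        tsub_tsub_tsub_cancel_right hcb]
    · rw [if_neg, component_apply_of_not_le hb, mul_zero]
      intro h
      exact hb ((tsub_le_tsub_iff_right hc).1 h)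
  · rw [component_apply_of_not_le hc]
    refine (Finset.sum_eq_zero fun b _ => ?_).symm
    by_cases h0 : coeff (δ b - ε c) (f (Pi.single b 1) c) = 0
    · rw [h0, zero_mul]
    · rw [component_apply_of_not_le (fun hb => hc ((hf.le_of_coeff_ne_zero h0).trans hb)),
        mul_zero]

lemma IsGradedMap.apply_homogenize (hf : IsGradedMap δ ε f) {v : Fin r → 𝕜}
    (hv : ∀ b, ¬ δ b ≤ a → v b = 0) :
    f (homogenize δ a v) = homogenize ε a (scalarMatrix δ ε f v) := by
  classical
  funext c
  rw [linearMap_apply_eq_sum]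
  by_cases hc : ε c ≤ a
  · rw [homogenize_apply_of_le hc, scalarMatrix_apply, map_sum]
    refine Finset.sum_congr rfl fun b _ => ?_
    rw [hf.apply_single, coeff_monomial, if_pos rfl]
    by_cases h0 : coeff (δ b - ε c) (f (Pi.single b 1) c) = 0
    · simp [h0]
    by_cases hb : δ b ≤ a
    · rw [homogenize_apply_of_le hb, monomial_mul, mul_comm (v b),
        tsub_add_tsub_cancel hb (hf.le_of_coeff_ne_zero h0)]
    · rw [homogenize_apply_of_not_le hb, hv b hb, zero_mul, mul_zero, map_zero]
  · rw [homogenize_apply_of_not_le hc]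
    refine Finset.sum_eq_zero fun b _ => ?_
    by_cases hb : δ b ≤ a
    · rw [hf.apply_single]
      by_cases h0 : coeff (δ b - ε c) (f (Pi.single b 1) c) = 0
      · simp [h0]
      · exact absurd ((hf.le_of_coeff_ne_zero h0).trans hb) hc
    · rw [homogenize_apply_of_not_le hb, zero_mul]

lemma scalarMatrix_comp_eq_zero (hf : IsGradedMap δ ε f) (hg : IsGradedMap ε η g)
    (h : ∀ y, g (f y) = 0) (v : Fin r → 𝕜) :
    scalarMatrix ε η g (scalarMatrix δ ε f v) = 0 := by
  have key : scalarMatrix ε η g ∘ₗ scalarMatrix δ ε f = 0 := by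
    refine LinearMap.pi_ext' fun b => LinearMap.ext_ring ?_
    -- A basis vector is its own component in its own degree, so the identity can be tested in the
    -- degree `δ b`.
    have hb : component δ (δ b) (Pi.single b 1 : Fin r → MvPolynomial σ 𝕜) = Pi.single b 1 := by
      funext c
      by_cases hc : δ c ≤ δ b
      · rw [component_apply_of_le hc]
        by_cases hcb : c = b
        · subst hcb; simp
        · simp [hcb]
      · have : c ≠ b := fun h => hc (h ▸ le_rfl)
        rw [component_apply_of_not_le hc, Pi.single_eq_of_ne this]
    change scalarMatrix ε η g (scalarMatrix δ ε f (Pi.single b 1)) = 0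
    rw [← hb, ← hf.component_apply, ← hg.component_apply, h, map_zero]
  exact LinearMap.congr_fun key v

lemma exists_scalarMatrix_eq (hf : IsGradedMap δ ε f) (hg : IsGradedMap ε η g)
    (h : LinearMap.ker g = LinearMap.range f) {v : Fin s → 𝕜}
    (hv : ∀ b, ¬ ε b ≤ a → v b = 0) (h0 : scalarMatrix ε η g v = 0) :
    ∃ w : Fin r → 𝕜, (∀ b, ¬ δ b ≤ a → w b = 0) ∧ scalarMatrix δ ε f w = v := by
  have hker : homogenize ε a v ∈ LinearMap.ker g := by
    rw [LinearMap.mem_ker, hg.apply_homogenize hv, h0, map_zero]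
  rw [h] at hker
  obtain ⟨y, hy⟩ := hker
  refine ⟨component δ a y, fun b hb => component_apply_of_not_le hb y, ?_⟩
  rw [← hf.component_apply, hy, component_homogenize hv]

end GradedFree

/-! ### Boxes of degrees, interpolating between `Set.Iic a` and `{a}`. -/

section Box

variable {σ : Type*}

/-- The degrees below `a` which agree with `a` in the coordinates belonging to `L`. -/
def box (a : σ →₀ ℕ) (L : Finset σ) : Set (σ →₀ ℕ) :=
  {b | b ≤ a ∧ ∀ j ∈ L, b j = a j}

lemma box_empty (a : σ →₀ ℕ) : box a ∅ = Set.Iic a := by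
  ext b; simp [box]

lemma box_univ [Fintype σ] (a : σ →₀ ℕ) : box a Finset.univ = {a} := by
  ext b
  simp only [box, Finset.mem_univ, forall_const, Set.mem_ofPred_eq, Set.mem_singleton_iff]
  exact ⟨fun h => Finsupp.ext h.2, fun h => by simp [h]⟩

lemma box_ordConnected (a : σ →₀ ℕ) (L : Finset σ) : (box a L).OrdConnected :=
  ⟨fun _ hx _ hy _ hz => ⟨hz.2.trans hy.1, fun j hj =>
    le_antisymm ((hz.2.trans hy.1) j) (hx.2 j hj ▸ hz.1 j)⟩⟩

variable [DecidableEq σ]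

lemma box_insert_of_eq_zero {a : σ →₀ ℕ} {j : σ} (hj : a j = 0) (L : Finset σ) :
    box a (insert j L) = box a L := by
  ext b
  simp only [box, Finset.mem_insert, forall_eq_or_imp, Set.mem_ofPred_eq]
  refine ⟨fun h => ⟨h.1, h.2.2⟩, fun h => ⟨h.1, ?_, h.2⟩⟩
  have := h.1 j
  omega

lemma le_sub_single_iff {a b : σ →₀ ℕ} {j : σ} (hj : a j ≠ 0) :
    b ≤ a - Finsupp.single j 1 ↔ b ≤ a ∧ b j ≠ a j := by
  simp only [Finsupp.le_def, Finsupp.tsub_apply, Finsupp.single_apply]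
  constructor
  · intro h
    refine ⟨fun i => (h i).trans (Nat.sub_le _ _), fun h' => ?_⟩
    have := h j
    rw [if_pos rfl] at this
    omega
  · rintro ⟨h, h'⟩ i
    have := h i
    split_ifs with hi
    · subst hi; omega
    · omega

lemma box_sub_single_eq {a : σ →₀ ℕ} {j : σ} (hj : a j ≠ 0) {L : Finset σ} (hjL : j ∉ L) :
    box (a - Finsupp.single j 1) L = {b | b ∈ box a L ∧ b j ≠ a j} := by
  ext b
  have : ∀ i ∈ L, (a - Finsupp.single j 1 : σ →₀ ℕ) i = a i := fun i hi => by
    have : j ≠ i := fun h => hjL (h ▸ hi)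
    simp [this]
  simp only [box, le_sub_single_iff hj, Set.mem_ofPred_eq]
  constructor
  · rintro ⟨⟨h1, h2⟩, h3⟩
    exact ⟨⟨h1, fun i hi => by rw [h3 i hi, this i hi]⟩, h2⟩
  · rintro ⟨⟨h1, h2⟩, h3⟩
    exact ⟨⟨h1, h3⟩, fun i hi => by rw [this i hi, h2 i hi]⟩

lemma box_insert {a : σ →₀ ℕ} {j : σ} (hj : a j ≠ 0) {L : Finset σ} (hjL : j ∉ L) :
    box a (insert j L) = box a L \ box (a - Finsupp.single j 1) L := by
  rw [box_sub_single_eq hj hjL]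
  ext b
  simp only [box, Finset.mem_insert, forall_eq_or_imp, Set.mem_ofPred_eq, Set.mem_sdiff]
  tauto

lemma box_isLowerIn {a : σ →₀ ℕ} {j : σ} (hj : a j ≠ 0) {L : Finset σ} (hjL : j ∉ L) :
    ScalarComplex.IsLowerIn (box (a - Finsupp.single j 1) L) (box a L) := by
  rw [box_sub_single_eq hj hjL]
  refine ⟨fun b hb => hb.1, fun x hx y hy hyx => ⟨hy, ?_⟩⟩
  have h1 := hx.1.1 j
  have h2 := hyx j
  have h3 := hx.2
  omega

end Box

/-! ### Strands of a resolution and Betti numbers. -/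

namespace MinimalGradedFreeResolution

variable {𝕜 : Type*} [Field 𝕜] {σ : Type*} {I : Ideal (MvPolynomial σ 𝕜)}
  (F : MinimalGradedFreeResolution I)

/-- The augmentation as a map to a free module of rank one. -/
def augMap : (Fin (F.rank 0) → MvPolynomial σ 𝕜) →ₗ[MvPolynomial σ 𝕜]
    (Fin 1 → MvPolynomial σ 𝕜) :=
  LinearMap.pi fun _ => F.aug

lemma isGradedMap_diff (i : ℕ) : IsGradedMap (F.deg (i + 1)) (F.deg i) (F.diff i) :=
  F.diff_graded i

lemma isGradedMap_augMap : IsGradedMap (F.deg 0) (0 : Fin 1 → (σ →₀ ℕ)) F.augMap := by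
  intro b c m hm
  rw [Pi.zero_apply, add_zero]
  exact F.aug_graded b m hm

lemma ker_augMap : LinearMap.ker F.augMap = LinearMap.range (F.diff 0) := by
  rw [← F.exact_zero]
  ext y
  simp [augMap, funext_iff]

lemma augMap_diff (y) : F.augMap (F.diff 0 y) = 0 := by
  have : F.diff 0 y ∈ LinearMap.ker F.augMap := by
    rw [ker_augMap]; exact ⟨y, rfl⟩
  exact this

lemma diff_diff (i : ℕ) (y) : F.diff i (F.diff (i + 1) y) = 0 := by
  have : F.diff (i + 1) y ∈ LinearMap.ker (F.diff i) := by
    rw [F.exact_succ]; exact ⟨y, rfl⟩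
  exact this

/-- The ranks of the modules of a resolution, with two zero modules appended at the bottom. -/
def shiftRank : ℕ → ℕ
  | 0 => 0
  | 1 => 0
  | i + 2 => F.rank i

def shiftDeg : ∀ i, Fin (F.shiftRank i) → (σ →₀ ℕ)
  | 0 => Fin.elim0
  | 1 => Fin.elim0
  | i + 2 => F.deg i

def shiftD : ∀ i, (Fin (F.shiftRank (i + 1)) → 𝕜) →ₗ[𝕜] (Fin (F.shiftRank i) → 𝕜)
  | 0 => 0
  | 1 => 0
  | i + 2 => scalarMatrix (F.deg (i + 1)) (F.deg i) (F.diff i)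

/-- The complex of scalars of a graded free resolution of an ideal, with homological degree `i`
placed at the index `i + 2`. -/
def scalarComplex : ScalarComplex 𝕜 (σ →₀ ℕ) where
  rank := F.shiftRank
  deg := F.shiftDeg
  d := F.shiftD
  d_d := by
    rintro (_ | _ | i) v
    · rfl
    · rfl
    · exact scalarMatrix_comp_eq_zero (F.isGradedMap_diff _) (F.isGradedMap_diff _)
        (F.diff_diff i) v
  d_le := by
    rintro (_ | _ | i) b c h
    · exact absurd rfl h
    · exact absurd rfl h
    · refine (F.isGradedMap_diff i).le_of_coeff_ne_zero ?_
      exact fun h0 => h ((scalarMatrix_single (f := F.diff i) b c).trans h0)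

/-- The scalars of the augmentation. -/
def augScalar : (Fin (F.rank 0) → 𝕜) →ₗ[𝕜] (Fin 1 → 𝕜) :=
  scalarMatrix (F.deg 0) 0 F.augMap

open ScalarComplex

lemma strand_Iic {i : ℕ} {a : σ →₀ ℕ} {v : Fin (F.scalarComplex.rank (i + 1)) → 𝕜}
    (hv : v ∈ F.scalarComplex.chains (Set.Iic a) (i + 1)) :
    F.scalarComplex.strand (Set.Iic a) i v = F.scalarComplex.d i v := by
  refine proj_eq_self fun c hc => ?_
  exact d_apply_eq_zero _ _ fun b hb => hv b fun hba => hc (hb.trans hba)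

/-- Index `1` carries a zero module. The long exact sequence lowers the index by one, and starting
from homological degree `0` it lands here; hence the two appended zero modules. -/
lemma exactAt_zero (Q : Set (σ →₀ ℕ)) : F.scalarComplex.ExactAt Q 0 :=
  fun _ _ _ => ⟨0, zero_mem _, funext fun b => b.elim0⟩

lemma exactAt_Iic_add_two (a : σ →₀ ℕ) (i : ℕ) :
    F.scalarComplex.ExactAt (Set.Iic a) (i + 2) := by
  intro v hv hdv
  rw [F.strand_Iic hv] at hdv
  obtain ⟨w, hw, hwv⟩ := exists_scalarMatrix_eq (F.isGradedMap_diff (i + 1))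
    (F.isGradedMap_diff i) (F.exact_succ i) hv hdv
  exact ⟨w, hw, (F.strand_Iic (i := i + 3) hw).trans hwv⟩

lemma exists_of_augScalar_eq_zero {a : σ →₀ ℕ} {v : Fin (F.rank 0) → 𝕜}
    (hv : v ∈ F.scalarComplex.chains (Set.Iic a) 2) (h : F.augScalar v = 0) :
    ∃ w ∈ F.scalarComplex.chains (Set.Iic a) 3,
      F.scalarComplex.strand (Set.Iic a) 2 w = v := by
  obtain ⟨w, hw, hwv⟩ := exists_scalarMatrix_eq (F.isGradedMap_diff 0)
    F.isGradedMap_augMap F.ker_augMap hv h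
  exact ⟨w, hw, (F.strand_Iic (i := 2) hw).trans hwv⟩

lemma augScalar_d (v : Fin (F.rank 1) → 𝕜) : F.augScalar (F.scalarComplex.d 2 v) = 0 :=
  scalarMatrix_comp_eq_zero (F.isGradedMap_diff 0) F.isGradedMap_augMap F.augMap_diff v

/-- The degree `a` part of the resolution resolves `I_a`, which is zero here. Only homological
degree `0` needs the hypothesis: a nonzero augmentation there would put the monomial into `I`. -/
lemma exactAt_Iic_of_notMem {a : σ →₀ ℕ} (ha : monomial a (1 : 𝕜) ∉ I) (i : ℕ) :
    F.scalarComplex.ExactAt (Set.Iic a) i := by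
  match i with
  | 0 => exact F.exactAt_zero _
  | i + 2 => exact F.exactAt_Iic_add_two a i
  | 1 =>
    intro v hv _
    refine F.exists_of_augScalar_eq_zero hv ?_
    have h := congrFun (F.isGradedMap_augMap.apply_homogenize (a := a) hv) 0
    rw [homogenize_apply_of_le zero_le] at h
    funext j
    rw [Subsingleton.elim j 0]
    by_contra hne
    refine ha ?_
    have hmem : F.aug (homogenize (F.deg 0) a v) ∈ I :=
      F.range_aug.le (LinearMap.mem_range_self _ _)
    have h2 : monomial a (1 : 𝕜) = C (F.augScalar v 0)⁻¹ * F.aug (homogenize (F.deg 0) a v) := by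
      refine Eq.trans ?_ (congrArg (C (F.augScalar v 0)⁻¹ * ·) h.symm)
      simp only [Pi.zero_apply, tsub_zero, C_mul_monomial]
      congr 1
      exact (inv_mul_cancel₀ hne).symm
    rw [h2]
    exact I.mul_mem_left _ hmem

lemma exists_augScalar_eq_one {a : σ →₀ ℕ} (ha : monomial a (1 : 𝕜) ∈ I) :
    ∃ w ∈ F.scalarComplex.chains (Set.Iic a) 2, F.augScalar w = 1 := by
  rw [← F.range_aug] at ha
  obtain ⟨y, hy⟩ := ha
  refine ⟨component (F.deg 0) a y, fun b hb => component_apply_of_not_le hb y, ?_⟩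
  refine (F.isGradedMap_augMap.component_apply y).symm.trans ?_
  funext j
  rw [component_apply_of_le zero_le]
  change coeff (a - 0) (F.aug y) = 1
  classical rw [hy, tsub_zero, coeff_monomial, if_pos rfl]

lemma exists_lift {a : σ →₀ ℕ} {w : Fin (F.rank 0) → 𝕜}
    (hw : w ∈ F.scalarComplex.chains (Set.Iic a) 2) (hw1 : F.augScalar w = 1)
    {v : Fin (F.rank 0) → 𝕜} (hv : v ∈ F.scalarComplex.chains (Set.Iic a) 2) :
    ∃ y ∈ F.scalarComplex.chains (Set.Iic a) 3,
      F.scalarComplex.strand (Set.Iic a) 2 y = v - F.augScalar v 0 • w := by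
  refine F.exists_of_augScalar_eq_zero (sub_mem hv (Submodule.smul_mem _ _ hw)) ?_
  funext j
  rw [map_sub, map_smul, hw1, Subsingleton.elim j 0]
  simp

lemma homologyDimOne_Iic_of_mem {a : σ →₀ ℕ} (ha : monomial a (1 : 𝕜) ∈ I) :
    F.scalarComplex.HomologyDimOne (Set.Iic a) 1 := by
  obtain ⟨w, hw, hw1⟩ := F.exists_augScalar_eq_one ha
  refine ⟨w, hw, funext fun b => b.elim0, fun y hy hyw => ?_, fun v hv _ => ?_⟩
  · rw [F.strand_Iic hy] at hyw
    have := F.augScalar_d y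
    rw [hyw, hw1] at this
    exact one_ne_zero (congrFun this 0)
  · exact ⟨_, F.exists_lift hw hw1 hv⟩

/-- Multiplication by `x_j` maps `I_(a - e_j)` isomorphically onto `I_a`, both being lines, so the
quotient strand is acyclic. Case `2` is injectivity and case `1` surjectivity of this map. -/
lemma exactAt_box_singleton [DecidableEq σ] {a : σ →₀ ℕ} {j : σ} (hj : a j ≠ 0)
    (ha : monomial (a - Finsupp.single j 1) (1 : 𝕜) ∈ I) (i : ℕ) :
    F.scalarComplex.ExactAt (box a {j}) i := by
  have hlow := box_isLowerIn hj (Finset.notMem_empty j)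
  have hord := box_ordConnected a ∅
  rw [← insert_empty_eq, box_insert hj (Finset.notMem_empty j)]
  rw [box_empty, box_empty] at *
  match i with
  | 0 => exact F.exactAt_zero _
  | i + 3 => exact (F.exactAt_Iic_add_two a (i + 1)).diff hord hlow (F.exactAt_Iic_add_two _ i)
  | 2 =>
    refine (F.exactAt_Iic_add_two a 0).diff_of_lift hord hlow fun u hu _ ⟨v, hv, hvu⟩ => ?_
    refine F.exists_of_augScalar_eq_zero hu ?_
    rw [F.strand_Iic hv] at hvu
    rw [← hvu]
    exact F.augScalar_d v
  | 1 =>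
    intro v hv _
    obtain ⟨w, hw, hw1⟩ := F.exists_augScalar_eq_one ha
    obtain ⟨y, hy, hyv⟩ := F.exists_lift (chains_mono hlow.1 hw) hw1
      (chains_mono Set.sdiff_subset hv)
    refine ⟨proj _ _ _ y, proj_mem _, ?_⟩
    rw [strand_diff_proj hlow hy, ← proj_diff_strand]
    rw [hyv]
    refine (map_sub (F.scalarComplex.proj _ 2) v (F.augScalar v 0 • w)).trans ?_
    rw [map_smul, proj_diff_eq_zero hw, smul_zero]
    exact (sub_zero _).trans (proj_eq_self hv)

/-- A matrix entry between basis vectors of equal degree is a constant, and minimality forbids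
nonzero constants. -/
lemma strand_singleton (a : σ →₀ ℕ) (i : ℕ) {v}
    (hv : v ∈ F.scalarComplex.chains {a} (i + 1)) : F.scalarComplex.strand {a} i v = 0 := by
  match i with
  | 0 => exact funext fun b => b.elim0
  | 1 => exact funext fun b => b.elim0
  | i + 2 =>
    funext c
    by_cases hc : F.deg i c = a
    · refine (proj_apply_mem (K := F.scalarComplex) (i := i + 2) _ hc).trans ?_
      refine (scalarMatrix_apply _ _).trans (Finset.sum_eq_zero fun b _ => ?_)
      by_cases hb : F.deg (i + 1) b = a
      · rw [hb, hc, tsub_self]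
        have := F.minimal i (Pi.single b 1) c
        rw [constantCoeff_eq] at this
        exact mul_eq_zero_of_left this _
      · exact mul_eq_zero_of_right _ (hv b hb)
    · exact proj_apply_notMem (K := F.scalarComplex) (i := i + 2) _ hc

lemma multiplicity_eq_zero [Fintype σ] {a : σ →₀ ℕ} {i : ℕ}
    (h : F.scalarComplex.ExactAt (box a Finset.univ) (i + 1)) : F.multiplicity i a = 0 := by
  rw [box_univ] at h
  rw [multiplicity, Nat.card_eq_zero]
  refine Or.inl ⟨fun ⟨b, hb⟩ => ?_⟩
  have hmem : (Pi.single b 1 : Fin (F.rank i) → 𝕜) ∈ F.scalarComplex.chains {a} (i + 2) :=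
    fun c hc => Pi.single_eq_of_ne (fun hcb : c = b => hc (by subst hcb; exact hb)) _
  obtain ⟨w, hw, hwv⟩ := h _ hmem (F.strand_singleton a _ hmem)
  rw [F.strand_singleton a _ hw] at hwv
  have := congrFun hwv b
  exact zero_ne_one (this.trans (Pi.single_eq_same _ _))

/-- With zero differential the homology is the span of the basis vectors of degree `a`; two
different ones cannot both be multiples of the same `z`. -/
lemma multiplicity_eq_one [Fintype σ] {a : σ →₀ ℕ} {i : ℕ}
    (h : F.scalarComplex.HomologyDimOne (box a Finset.univ) (i + 1)) :
    F.multiplicity i a = 1 := by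
  rw [box_univ] at h
  obtain ⟨z, hz, -, hne, hspan⟩ := h
  have hsp : ∀ b : Fin (F.rank i), F.deg i b = a →
      ∃ c : 𝕜, (Pi.single b 1 : Fin (F.rank i) → 𝕜) = c • z := by
    intro b hb
    have hmem : (Pi.single b 1 : Fin (F.rank i) → 𝕜) ∈ F.scalarComplex.chains {a} (i + 2) :=
      fun c hc => Pi.single_eq_of_ne (fun hcb : c = b => hc (by subst hcb; exact hb)) _
    obtain ⟨c, w, hw, hwv⟩ := hspan _ hmem (F.strand_singleton a _ hmem)
    rw [F.strand_singleton a _ hw] at hwv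
    exact ⟨c, sub_eq_zero.1 hwv.symm⟩
  have hz0 : z ≠ 0 := fun h0 => hne 0 (zero_mem _) (by rw [map_zero, h0])
  obtain ⟨b, hb⟩ := Function.ne_iff.1 hz0
  have hba : F.deg i b = a := by
    by_contra hba
    exact hb (hz b hba)
  rw [multiplicity, Nat.card_eq_one_iff_unique]
  refine ⟨⟨fun ⟨x, hx⟩ ⟨y, hy⟩ => Subtype.ext ?_⟩, ⟨b, hba⟩⟩
  by_contra hxy
  change x ≠ y at hxy
  obtain ⟨c, hc⟩ := hsp x hx
  obtain ⟨e, he⟩ := hsp y hy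
  have h1 : (1 : 𝕜) = c * z x := (Pi.single_eq_same (M := fun _ => 𝕜) x 1).symm.trans (congrFun hc x)
  have h2 : (0 : 𝕜) = c * z y := by
    rw [← Pi.single_eq_of_ne (M := fun _ => 𝕜) (Ne.symm hxy) (1 : 𝕜)]
    exact congrFun hc y
  have h3 : (1 : 𝕜) = e * z y := (Pi.single_eq_same (M := fun _ => 𝕜) y 1).symm.trans (congrFun he y)
  rcases mul_eq_zero.1 h2.symm with h | h
  · rw [h, zero_mul] at h1; exact one_ne_zero h1
  · rw [h, mul_zero] at h3; exact one_ne_zero h3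

end MinimalGradedFreeResolution

/-! ### Minimal homogeneous generators. -/

section MinimalGenerators

variable {𝕜 : Type*} [Field 𝕜] {σ : Type*} {r s : ℕ} {δ : Fin r → (σ →₀ ℕ)}
  {ε : Fin s → (σ →₀ ℕ)}
  {f : (Fin r → MvPolynomial σ 𝕜) →ₗ[MvPolynomial σ 𝕜] (Fin s → MvPolynomial σ 𝕜)}

/-- A submodule of a graded free module which contains the homogeneous components of its
elements. -/
def IsGradedSubmodule (δ : Fin r → (σ →₀ ℕ))
    (N : Submodule (MvPolynomial σ 𝕜) (Fin r → MvPolynomial σ 𝕜)) : Prop :=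
  ∀ y ∈ N, ∀ a, homogenize δ a (component δ a y) ∈ N

lemma IsGradedMap.isGradedSubmodule_ker (hf : IsGradedMap δ ε f) :
    IsGradedSubmodule δ (LinearMap.ker f) := by
  intro y hy a
  rw [LinearMap.mem_ker] at hy ⊢
  rw [hf.apply_homogenize fun b hb => component_apply_of_not_le hb y, ← hf.component_apply, hy,
    map_zero, map_zero]

lemma exists_finset_sum_component (y : Fin r → MvPolynomial σ 𝕜) :
    ∃ A : Finset (σ →₀ ℕ), y = ∑ a ∈ A, homogenize δ a (component δ a y) := by
  classical
  refine ⟨Finset.univ.biUnion fun b => (y b).support.image (· + δ b), ?_⟩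
  funext b
  ext m
  rw [Finset.sum_apply, coeff_sum, Finset.sum_eq_single (m + δ b)]
  · rw [homogenize_apply_of_le le_add_self, component_apply_of_le le_add_self, coeff_monomial,
      add_tsub_cancel_right, if_pos rfl]
  · intro a _ ha
    by_cases hb : δ b ≤ a
    · rw [homogenize_apply_of_le hb, coeff_monomial, if_neg]
      rintro rfl
      exact ha (tsub_add_cancel_of_le hb).symm
    · rw [homogenize_apply_of_not_le hb, coeff_zero]
  · intro h
    rw [homogenize_apply_of_le le_add_self, component_apply_of_le le_add_self, coeff_monomial,
      add_tsub_cancel_right, if_pos rfl]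
    by_contra hm
    exact h (Finset.mem_biUnion.2 ⟨b, Finset.mem_univ _,
      Finset.mem_image.2 ⟨m, mem_support_iff.2 hm, rfl⟩⟩)

/-- Take a homogeneous generating set of least cardinality, finite by noetherianity. A relation with
a nonzero constant coefficient would express one generator through the others. -/
lemma exists_minimal_generators [Finite σ]
    {N : Submodule (MvPolynomial σ 𝕜) (Fin r → MvPolynomial σ 𝕜)}
    (hN : IsGradedSubmodule δ N) :
    ∃ (s : ℕ) (ε : Fin s → (σ →₀ ℕ))
      (f : (Fin s → MvPolynomial σ 𝕜) →ₗ[MvPolynomial σ 𝕜] (Fin r → MvPolynomial σ 𝕜)),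
      IsGradedMap ε δ f ∧ LinearMap.range f = N ∧
        ∀ y ∈ LinearMap.ker f, ∀ b, constantCoeff (y b) = 0 := by
  classical
  set H : Set (Fin r → MvPolynomial σ 𝕜) := {y | y ∈ N ∧ ∃ a v, y = homogenize δ a v} with hH
  have hspan : Submodule.span (MvPolynomial σ 𝕜) H = N := by
    refine le_antisymm (Submodule.span_le.2 fun y hy => hy.1) fun y hy => ?_
    obtain ⟨A, hA⟩ := exists_finset_sum_component (δ := δ) y
    rw [hA]
    exact Submodule.sum_mem _ fun a _ => Submodule.subset_span ⟨hN y hy a, a, _, rfl⟩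
  have hex : ∃ n, ∃ T : Finset (Fin r → MvPolynomial σ 𝕜), (T : Set _) ⊆ H ∧
      Submodule.span (MvPolynomial σ 𝕜) (T : Set (Fin r → MvPolynomial σ 𝕜)) = N ∧
      T.card = n := by
    obtain ⟨T, hT, hTs⟩ := (Submodule.fg_span_iff_fg_span_finset_subset H).1
      (IsNoetherian.noetherian (Submodule.span (MvPolynomial σ 𝕜) H))
    exact ⟨_, T, hT, hTs ▸ hspan, rfl⟩
  obtain ⟨T, hT, hTs, hcard⟩ := Nat.find_spec hex
  have hmin : ∀ y ∈ T, y ∉ Submodule.span (MvPolynomial σ 𝕜)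
      ((T.erase y : Finset _) : Set (Fin r → MvPolynomial σ 𝕜)) := by
    intro y hy hmem
    refine Nat.find_min hex (m := (T.erase y).card) ?_ ⟨T.erase y, ?_, ?_, rfl⟩
    · rw [← hcard]; exact Finset.card_erase_lt_of_mem hy
    · exact fun z hz => hT (Finset.mem_of_mem_erase hz)
    · refine le_antisymm ((Submodule.span_mono fun z hz => Finset.mem_of_mem_erase hz).trans
        hTs.le) ?_
      rw [← hTs, Submodule.span_le]
      intro z hz
      by_cases hzy : z = y
      · rw [hzy]; exact hmem
      · exact Submodule.subset_span (Finset.mem_erase.2 ⟨hzy, hz⟩)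
  let g : Fin T.card → (Fin r → MvPolynomial σ 𝕜) := fun b => (T.equivFin.symm b : T)
  have hgT : ∀ b, g b ∈ T := fun b => (T.equivFin.symm b).2
  have hginj : Function.Injective g := fun b c h => T.equivFin.symm.injective (Subtype.ext h)
  have hgr : Set.range g = T := by
    ext y
    exact ⟨fun ⟨b, hb⟩ => hb ▸ hgT b, fun hy => ⟨T.equivFin ⟨y, hy⟩, by simp [g]⟩⟩
  choose ε v hv using fun b => (hT (hgT b)).2
  have hf1 : ∀ b, Fintype.linearCombination (MvPolynomial σ 𝕜) g (Pi.single b 1) = g b :=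
    fun b => by rw [Fintype.linearCombination_apply_single, one_smul]
  have hgraded : IsGradedMap ε δ (Fintype.linearCombination (MvPolynomial σ 𝕜) g) := by
    intro b c m hm
    rw [hf1, hv b] at hm
    by_cases hc : δ c ≤ ε b
    · rw [homogenize_apply_of_le hc] at hm
      rw [Finset.mem_singleton.1 (support_monomial_subset hm), tsub_add_cancel_of_le hc]
    · rw [homogenize_apply_of_not_le hc] at hm
      simp at hm
  refine ⟨T.card, ε, Fintype.linearCombination (MvPolynomial σ 𝕜) g, hgraded, ?_, ?_⟩
  · rw [Fintype.range_linearCombination, hgr, hTs]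
  · intro y hy b
    by_contra hne
    -- The component of the relation in the degree of the generator `b` is again a relation, and its
    -- coefficient at `b` is exactly the constant, hence invertible.
    set z := homogenize ε (ε b) (component ε (ε b) y) with hz
    have hzker := hgraded.isGradedSubmodule_ker y hy (ε b)
    have hzb : z b = C (constantCoeff (y b)) := by
      rw [hz, homogenize_apply_of_le le_rfl, component_apply_of_le le_rfl, tsub_self,
        constantCoeff_eq]
      rfl
    rw [LinearMap.mem_ker, Fintype.linearCombination_apply,
      ← Finset.add_sum_erase _ _ (Finset.mem_univ b)] at hzker
    refine hmin (g b) (hgT b) ?_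
    have hgb : g b = (C (constantCoeff (y b))⁻¹ : MvPolynomial σ 𝕜) • z b • g b := by
      rw [smul_smul, hzb, ← C_mul, inv_mul_cancel₀ hne, C_1, one_smul]
    have hmem : z b • g b ∈ Submodule.span (MvPolynomial σ 𝕜)
        ((T.erase (g b) : Finset _) : Set (Fin r → MvPolynomial σ 𝕜)) := by
      rw [eq_neg_of_add_eq_zero_left hzker]
      refine Submodule.neg_mem _ (Submodule.sum_mem _ fun c hc => Submodule.smul_mem _ _ ?_)
      exact Submodule.subset_span (Finset.mem_erase.2
        ⟨fun h => Finset.ne_of_mem_erase hc (hginj h), hgT c⟩)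
    have := Submodule.smul_mem _ (C (constantCoeff (y b))⁻¹ : MvPolynomial σ 𝕜) hmem
    rwa [← hgb] at this

lemma ker_proj_zero_comp (f : (Fin r → MvPolynomial σ 𝕜) →ₗ[MvPolynomial σ 𝕜]
    (Fin 1 → MvPolynomial σ 𝕜)) :
    LinearMap.ker (LinearMap.proj (φ := fun _ : Fin 1 => MvPolynomial σ 𝕜) 0 ∘ₗ f)
      = LinearMap.ker f := by
  ext y
  simp [funext_iff]

end MinimalGenerators

/-! ### Existence of minimal resolutions by iterated syzygies. -/

section Existence

variable (𝕜 : Type*) [Field 𝕜] (σ : Type*)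

/-- A graded submodule of a graded free module of finite rank. -/
structure GradedSubmodule where
  rank : ℕ
  deg : Fin rank → (σ →₀ ℕ)
  carrier : Submodule (MvPolynomial σ 𝕜) (Fin rank → MvPolynomial σ 𝕜)
  isGraded : IsGradedSubmodule deg carrier

variable {𝕜 σ} [Finite σ]

namespace GradedSubmodule

lemma exists_cover (N : GradedSubmodule 𝕜 σ) :
    ∃ (M : GradedSubmodule 𝕜 σ)
      (f : (Fin M.rank → MvPolynomial σ 𝕜) →ₗ[MvPolynomial σ 𝕜] (Fin N.rank → MvPolynomial σ 𝕜)),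
      IsGradedMap M.deg N.deg f ∧ LinearMap.range f = N.carrier ∧ M.carrier = LinearMap.ker f ∧
        ∀ y ∈ M.carrier, ∀ b, constantCoeff (y b) = 0 := by
  obtain ⟨s, ε, f, h1, h2, h3⟩ := exists_minimal_generators N.isGraded
  exact ⟨⟨s, ε, LinearMap.ker f, h1.isGradedSubmodule_ker⟩, f, h1, h2, rfl, h3⟩

/-- The kernel of a minimal cover of a graded submodule by a graded free module. -/
def syzygy (N : GradedSubmodule 𝕜 σ) : GradedSubmodule 𝕜 σ :=
  N.exists_cover.choose

/-- A minimal cover of a graded submodule by a graded free module. -/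
def cover (N : GradedSubmodule 𝕜 σ) :
    (Fin N.syzygy.rank → MvPolynomial σ 𝕜) →ₗ[MvPolynomial σ 𝕜]
      (Fin N.rank → MvPolynomial σ 𝕜) :=
  N.exists_cover.choose_spec.choose

lemma isGradedMap_cover (N : GradedSubmodule 𝕜 σ) : IsGradedMap N.syzygy.deg N.deg N.cover :=
  N.exists_cover.choose_spec.choose_spec.1

lemma range_cover (N : GradedSubmodule 𝕜 σ) : LinearMap.range N.cover = N.carrier :=
  N.exists_cover.choose_spec.choose_spec.2.1

lemma syzygy_carrier (N : GradedSubmodule 𝕜 σ) : N.syzygy.carrier = LinearMap.ker N.cover :=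
  N.exists_cover.choose_spec.choose_spec.2.2.1

lemma constantCoeff_of_mem_syzygy (N : GradedSubmodule 𝕜 σ) :
    ∀ y ∈ N.syzygy.carrier, ∀ b, constantCoeff (y b) = 0 :=
  N.exists_cover.choose_spec.choose_spec.2.2.2

/-- The iterated syzygies of a graded submodule. -/
def syzygies (N : GradedSubmodule 𝕜 σ) : ℕ → GradedSubmodule 𝕜 σ
  | 0 => N
  | i + 1 => (N.syzygies i).syzygy

end GradedSubmodule

/-- A monomial ideal as a graded submodule of the free module of rank one. -/
def monomialIdealSubmodule (I : Ideal (MvPolynomial σ 𝕜))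
    (hI : ∀ p ∈ I, ∀ a, monomial a (coeff a p) ∈ I) : GradedSubmodule 𝕜 σ where
  rank := 1
  deg := 0
  carrier := Submodule.comap (LinearMap.proj 0) I
  isGraded := by
    intro y hy a
    change homogenize 0 a (component 0 a y) 0 ∈ I
    rw [homogenize_apply_of_le zero_le, component_apply_of_le zero_le, Pi.zero_apply, tsub_zero]
    exact hI _ hy a

lemma exists_minimalGradedFreeResolution (I : Ideal (MvPolynomial σ 𝕜))
    (hI : ∀ p ∈ I, ∀ a, monomial a (coeff a p) ∈ I) :
    Nonempty (MinimalGradedFreeResolution I) := by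
  let N := monomialIdealSubmodule I hI
  have hmem : ∀ y : Fin 1 → MvPolynomial σ 𝕜, y ∈ N.carrier ↔ y 0 ∈ I := fun _ => Iff.rfl
  have hrange : ∀ i, LinearMap.range (N.syzygies (i + 1)).cover
      = LinearMap.ker (N.syzygies i).cover := fun i =>
    (N.syzygies (i + 1)).range_cover.trans (N.syzygies i).syzygy_carrier
  exact ⟨{
    rank := fun i => (N.syzygies (i + 1)).rank
    deg := fun i => (N.syzygies (i + 1)).deg
    diff := fun i => (N.syzygies (i + 1)).cover
    aug := LinearMap.proj (φ := fun _ : Fin 1 => MvPolynomial σ 𝕜) 0 ∘ₗ (N.syzygies 0).cover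
    diff_graded := fun i => (N.syzygies (i + 1)).isGradedMap_cover
    aug_graded := fun b m hm => by
      have := (N.syzygies 0).isGradedMap_cover b (0 : Fin 1) m hm
      exact (add_zero m).symm.trans this
    range_aug := by
      ext p
      constructor
      · rintro ⟨y, rfl⟩
        exact (hmem _).1 (N.range_cover.le (LinearMap.mem_range_self _ y))
      · intro hp
        obtain ⟨y, hy⟩ := N.range_cover.ge ((hmem fun _ => p).2 hp)
        exact ⟨y, congrFun hy (0 : Fin 1)⟩
    exact_zero := (ker_proj_zero_comp (N.syzygies 0).cover).trans (hrange 0).symm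
    exact_succ := fun i => (hrange (i + 1)).symm
    minimal := fun i x c => (N.syzygies i).constantCoeff_of_mem_syzygy _
      ((N.syzygies (i + 1)).range_cover.le (LinearMap.mem_range_self _ x)) c }⟩

end Existence

/-! ### Monomials in Stanley–Reisner ideals and their duals. -/

lemma squarefreeExp_apply {σ : Type*} [DecidableEq σ] (s : Finset σ) (i : σ) :
    squarefreeExp s i = if i ∈ s then 1 else 0 := by
  simp [squarefreeExp, Finsupp.finsetSum_apply, Finsupp.single_apply]

lemma squarefreeExp_le_iff {σ : Type*} {s t : Finset σ} :
    squarefreeExp s ≤ squarefreeExp t ↔ s ⊆ t := by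
  classical
  simp only [Finsupp.le_def, squarefreeExp_apply]
  refine ⟨fun h i hi => ?_, fun h i => ?_⟩
  · have := h i
    rw [if_pos hi] at this
    by_contra hit
    rw [if_neg hit] at this
    omega
  · by_cases hi : i ∈ s
    · rw [if_pos hi, if_pos (h hi)]
    · rw [if_neg hi]; exact Nat.zero_le _

section

variable {𝕜 : Type*} [Field 𝕜] {σ : Type*}

lemma monomial_mem_stanleyReisnerIdeal_iff {Δ : LowerSet (Finset σ)} {s : Finset σ} :
    monomial (squarefreeExp s) (1 : 𝕜) ∈ stanleyReisnerIdeal 𝕜 Δ ↔ s ∉ Δ := by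
  refine ⟨fun h => ?_, fun h => Ideal.subset_span ⟨s, h, rfl⟩⟩
  have heq : {p : MvPolynomial σ 𝕜 | ∃ t : Finset σ, t ∉ Δ ∧ p = monomial (squarefreeExp t) 1}
      = (fun e => monomial e (1 : 𝕜)) '' {e | ∃ t : Finset σ, t ∉ Δ ∧ e = squarefreeExp t} := by
    ext p
    constructor
    · rintro ⟨t, ht, rfl⟩
      exact ⟨_, ⟨t, ht, rfl⟩, rfl⟩
    · rintro ⟨_, ⟨t, ht, rfl⟩, rfl⟩
      exact ⟨t, ht, rfl⟩
  rw [stanleyReisnerIdeal, heq, mem_ideal_span_monomial_image] at h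
  obtain ⟨_, ⟨t, ht, rfl⟩, hle⟩ := h (squarefreeExp s) (by classical simp [support_monomial])
  exact fun hs => ht (Δ.lower (squarefreeExp_le_iff.1 hle) hs)

lemma mem_alexanderDual_stanleyReisnerIdeal_iff {Δ : LowerSet (Finset σ)}
    {p : MvPolynomial σ 𝕜} :
    p ∈ alexanderDual (stanleyReisnerIdeal 𝕜 Δ) ↔
      ∀ s : Finset σ, s ∉ Δ → ∀ m ∈ p.support, ∃ i ∈ s, m i ≠ 0 := by
  simp only [alexanderDual, Ideal.mem_iInf, Set.mem_ofPred_eq,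
    monomial_mem_stanleyReisnerIdeal_iff, mem_ideal_span_X_image, Finset.mem_coe]

lemma monomial_coeff_mem_alexanderDual {Δ : LowerSet (Finset σ)} {p : MvPolynomial σ 𝕜}
    (hp : p ∈ alexanderDual (stanleyReisnerIdeal 𝕜 Δ)) (a : σ →₀ ℕ) :
    monomial a (coeff a p) ∈ alexanderDual (stanleyReisnerIdeal 𝕜 Δ) := by
  rw [mem_alexanderDual_stanleyReisnerIdeal_iff] at hp ⊢
  intro s hs m hm
  refine hp s hs m ?_
  have hma := Finset.mem_singleton.1 (support_monomial_subset hm)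
  classical
  rw [mem_support_iff, coeff_monomial, if_pos hma.symm] at hm
  rw [hma, mem_support_iff]
  exact hm

lemma monomial_mem_alexanderDual_iff [Fintype σ] {Δ : LowerSet (Finset σ)} {a : σ →₀ ℕ} :
    monomial a (1 : 𝕜) ∈ alexanderDual (stanleyReisnerIdeal 𝕜 Δ) ↔
      (Finset.univ.filter fun i => a i = 0) ∈ Δ := by
  classical
  simp only [mem_alexanderDual_stanleyReisnerIdeal_iff, support_monomial, one_ne_zero, if_false,
    Finset.mem_singleton, forall_eq]
  constructor
  · intro h
    by_contra hs
    obtain ⟨i, hi, hi0⟩ := h _ hs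
    exact hi0 (Finset.mem_filter.1 hi).2
  · intro h s hs
    by_contra! hne
    exact hs (Δ.lower (fun i hi => Finset.mem_filter.2 ⟨Finset.mem_univ _, hne i hi⟩) h)

end

/-! ### Strands of the dual ideal as simplicial complexes. -/

section FaceStrands

variable {𝕜 : Type*} [Field 𝕜] {X : Type*} [Fintype X] [DecidableEq X]
  {Δ : LowerSet (Finset X)}
  (F : MinimalGradedFreeResolution (alexanderDual (stanleyReisnerIdeal 𝕜 Δ)))

lemma filter_squarefreeExp_compl (t : Finset X) :
    (Finset.univ.filter fun i => squarefreeExp tᶜ i = 0) = t := by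
  ext i
  simp [squarefreeExp_apply]

lemma squarefreeExp_compl_sub_single (t : Finset X) (j : X) :
    squarefreeExp tᶜ - Finsupp.single j 1 = squarefreeExp (insert j t)ᶜ := by
  ext i
  simp only [Finsupp.tsub_apply, squarefreeExp_apply, Finsupp.single_apply, Finset.mem_compl,
    Finset.mem_insert]
  by_cases h : j = i
  · subst h; split_ifs <;> simp_all
  · simp [h, Ne.symm h]

lemma monomial_compl_mem_iff {t : Finset X} :
    monomial (squarefreeExp tᶜ) (1 : 𝕜) ∈ alexanderDual (stanleyReisnerIdeal 𝕜 Δ) ↔ t ∈ Δ := by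
  rw [monomial_mem_alexanderDual_iff, filter_squarefreeExp_compl]

lemma box_compl_insert_of_mem {t : Finset X} {j : X} (hj : j ∈ t) (L : Finset X) :
    box (squarefreeExp tᶜ) (insert j L) = box (squarefreeExp tᶜ) L :=
  box_insert_of_eq_zero (by simp [squarefreeExp_apply, hj]) L

/-- Exactness at the index `i + 1` of the strand of a resolution of the dual ideal of `Δ` which
computes the homology of the complex of those subsets of `L` whose union with `t` is a face. -/
def FaceExactAt (t L : Finset X) (i : ℕ) : Prop :=
  F.scalarComplex.ExactAt (box (squarefreeExp tᶜ) L) i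

/-- Exactness of the strand at all indices. -/
def FaceAcyclic (t L : Finset X) : Prop :=
  ∀ i, FaceExactAt F t L i

/-- One-dimensional homology of the strand at the index `i + 1`. -/
def FaceDimOne (t L : Finset X) (i : ℕ) : Prop :=
  F.scalarComplex.HomologyDimOne (box (squarefreeExp tᶜ) L) i

variable {F} {t L : Finset X} {i : ℕ} {j : X}

/-- Subsets of `insert j L` either avoid `j`, giving the strand of `t`, or contain it, giving the
strand of `insert j t` shifted by one. -/
lemma FaceExactAt.insert (h : FaceExactAt F t L (i + 1)) (h' : FaceExactAt F (insert j t) L i) :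
    FaceExactAt F t (insert j L) (i + 1) := by
  by_cases hL : j ∈ L
  · rwa [Finset.insert_eq_of_mem hL]
  by_cases ht : j ∈ t
  · rw [FaceExactAt, box_compl_insert_of_mem ht]; exact h
  · have hj : squarefreeExp tᶜ j ≠ 0 := by simp [squarefreeExp_apply, ht]
    rw [FaceExactAt, box_insert hj hL]
    refine ScalarComplex.ExactAt.diff (box_ordConnected _ _) (box_isLowerIn hj hL) h ?_
    rwa [squarefreeExp_compl_sub_single]

lemma FaceAcyclic.insert (h : FaceAcyclic F t L) (h' : FaceAcyclic F (insert j t) L) :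
    FaceAcyclic F t (insert j L)
  | 0 => F.exactAt_zero _
  | i + 1 => (h (i + 1)).insert (h' i)

lemma FaceAcyclic.of_insert (h : FaceAcyclic F t (Insert.insert j L))
    (h' : FaceAcyclic F (Insert.insert j t) L) : FaceAcyclic F t L := by
  by_cases hL : j ∈ L
  · rwa [Finset.insert_eq_of_mem hL] at h
  by_cases ht : j ∈ t
  · rwa [Finset.insert_eq_of_mem ht] at h'
  · have hj : squarefreeExp tᶜ j ≠ 0 := by simp [squarefreeExp_apply, ht]
    intro i
    have h1 := h i
    have h2 := h' i
    rw [FaceExactAt, box_insert hj hL] at h1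
    rw [FaceExactAt, ← squarefreeExp_compl_sub_single] at h2
    exact h2.of_lower_of_diff (box_ordConnected _ _) (box_isLowerIn hj hL) h1

lemma FaceDimOne.insert_succ (h : FaceDimOne F (Insert.insert j t) L i)
    (h' : FaceAcyclic F t L) (ht : j ∉ t) (hL : j ∉ L) :
    FaceDimOne F t (Insert.insert j L) (i + 1) := by
  have hj : squarefreeExp tᶜ j ≠ 0 := by simp [squarefreeExp_apply, ht]
  rw [FaceDimOne, box_insert hj hL]
  refine ScalarComplex.HomologyDimOne.diff_succ (box_ordConnected _ _) (box_isLowerIn hj hL)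
    (h' i) (h' (i + 1)) ?_
  rwa [squarefreeExp_compl_sub_single]

lemma FaceDimOne.insert (h : FaceDimOne F t L (i + 1))
    (h' : FaceAcyclic F (Insert.insert j t) L) :
    FaceDimOne F t (Insert.insert j L) (i + 1) := by
  by_cases hL : j ∈ L
  · rwa [Finset.insert_eq_of_mem hL]
  by_cases ht : j ∈ t
  · rw [FaceDimOne, box_compl_insert_of_mem ht]; exact h
  · have hj : squarefreeExp tᶜ j ≠ 0 := by simp [squarefreeExp_apply, ht]
    rw [FaceDimOne, box_insert hj hL]
    refine ScalarComplex.HomologyDimOne.diff (box_ordConnected _ _) (box_isLowerIn hj hL) ?_ ?_ h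
    · rw [squarefreeExp_compl_sub_single]; exact h' i
    · rw [squarefreeExp_compl_sub_single]; exact h' (i + 1)

/-- No superset of a nonface is a face: the complex is void, without even the empty face. -/
lemma faceAcyclic_of_notMem (ht : t ∉ Δ) (L : Finset X) : FaceAcyclic F t L := by
  induction L using Finset.induction_on generalizing t with
  | empty =>
    intro i
    rw [FaceExactAt, box_empty]
    exact F.exactAt_Iic_of_notMem (fun h => ht (monomial_compl_mem_iff.1 h)) i
  | insert j L _ ih =>
    exact (ih ht).insert (ih fun h => ht (Δ.lower (Finset.subset_insert j t) h))

/-- Only the empty subset remains; it sits in homological degree `0`, at index `2`. In general a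
subset of size `i` corresponds to homological degree `i`. -/
lemma faceDimOne_empty (ht : t ∈ Δ) : FaceDimOne F t ∅ 1 := by
  rw [FaceDimOne, box_empty]
  exact F.homologyDimOne_Iic_of_mem (monomial_compl_mem_iff.2 ht)

lemma faceExactAt_empty (t : Finset X) (i : ℕ) : FaceExactAt F t ∅ (i + 2) := by
  rw [FaceExactAt, box_empty]
  exact F.exactAt_Iic_add_two _ i

lemma faceAcyclic_singleton (ht : j ∉ t) (h : Insert.insert j t ∈ Δ) : FaceAcyclic F t {j} := by
  intro i
  refine F.exactAt_box_singleton (by simp [squarefreeExp_apply, ht]) ?_ i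
  rw [squarefreeExp_compl_sub_single]
  exact monomial_compl_mem_iff.2 h

/-- A full simplex is a cone with apex `j`. -/
lemma faceAcyclic_simplex (ht : j ∉ t) (hL : j ∉ L) (h : Insert.insert j (t ∪ L) ∈ Δ) :
    FaceAcyclic F t (Insert.insert j L) := by
  induction L using Finset.induction_on generalizing t with
  | empty =>
    rw [Finset.union_empty] at h
    exact faceAcyclic_singleton ht h
  | insert l L _ ih =>
    rw [Finset.mem_insert, not_or] at hL
    rw [Finset.insert_comm]
    refine (ih ht hL.2 (Δ.lower ?_ h)).insert (ih ?_ hL.2 ?_)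
    · exact Finset.insert_subset_insert _
        (Finset.union_subset_union_right (Finset.subset_insert _ _))
    · rw [Finset.mem_insert, not_or]; exact ⟨hL.1, ht⟩
    · rwa [Finset.insert_union, ← Finset.union_insert]

/-- Vertices in `t` are invisible to the box, and vertices that cannot be joined to `t` contribute a
void complex. -/
lemma FaceExactAt.union (h : FaceExactAt F t L (i + 1)) {O : Finset X}
    (hO : ∀ x ∈ O, x ∈ t ∨ Insert.insert x t ∉ Δ) : FaceExactAt F t (L ∪ O) (i + 1) := by
  induction O using Finset.induction_on with
  | empty => rwa [Finset.union_empty]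
  | insert x O _ ih =>
    have ih' := ih fun y hy => hO y (Finset.mem_insert_of_mem hy)
    rw [Finset.union_insert]
    rcases hO x (Finset.mem_insert_self x O) with hx | hx
    · rw [FaceExactAt, box_compl_insert_of_mem hx]; exact ih'
    · exact FaceExactAt.insert ih' (faceAcyclic_of_notMem hx _ i)

-- The dual ideal is squarefree: if `a j ≥ 2`, the monomials of `a` and `a - e_j` are both in it or
-- both outside, so multiplication by `x_j` is an isomorphism between these degrees. Hence Betti
-- numbers vanish in nonsquarefree degrees.
variable (F) in
lemma exactAt_box_of_two_le {a : X →₀ ℕ} (hj : 2 ≤ a j) (hL : j ∉ L) (i : ℕ) :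
    F.scalarComplex.ExactAt (box a (Insert.insert j L)) i := by
  induction L using Finset.induction_on generalizing a i with
  | empty =>
    rw [insert_empty_eq]
    have hj0 : a j ≠ 0 := by omega
    by_cases ha : monomial a (1 : 𝕜) ∈ alexanderDual (stanleyReisnerIdeal 𝕜 Δ)
    · refine F.exactAt_box_singleton hj0 ?_ i
      rw [monomial_mem_alexanderDual_iff] at ha ⊢
      convert ha using 2
      rename_i x
      simp only [Finsupp.tsub_apply, Finsupp.single_apply]
      split_ifs with h
      · subst h; omega
      · rw [Nat.sub_zero]
    · have ha' : monomial (a - Finsupp.single j 1) (1 : 𝕜) ∉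
          alexanderDual (stanleyReisnerIdeal 𝕜 Δ) := by
        rw [monomial_mem_alexanderDual_iff] at ha ⊢
        refine fun h => ha (Δ.lower (Finset.monotone_filter_right _ fun x _ hx => ?_) h)
        rw [Finsupp.tsub_apply, hx, Nat.zero_sub]
      have hlow := box_isLowerIn hj0 (Finset.notMem_empty j)
      have hord := box_ordConnected a ∅
      rw [← insert_empty_eq, box_insert hj0 (Finset.notMem_empty j)]
      rw [box_empty, box_empty] at *
      cases i with
      | zero => exact F.exactAt_zero _
      | succ i =>
        exact (F.exactAt_Iic_of_notMem ha _).diff hord hlow (F.exactAt_Iic_of_notMem ha' i)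
  | insert l L hl ih =>
    rw [Finset.mem_insert, not_or] at hL
    rw [Finset.insert_comm]
    by_cases h0 : a l = 0
    · rw [box_insert_of_eq_zero h0]
      exact ih hj hL.2 i
    · have hlL : l ∉ Insert.insert j L := by
        rw [Finset.mem_insert, not_or]; exact ⟨Ne.symm hL.1, hl⟩
      rw [box_insert h0 hlL]
      cases i with
      | zero => exact F.exactAt_zero _
      | succ i =>
        refine (ih hj hL.2 _).diff (box_ordConnected _ _) (box_isLowerIn h0 hlL) (ih ?_ hL.2 i)
        have : l ≠ j := Ne.symm hL.1
        simpa [this] using hj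

variable (F) in
lemma exactAt_box_univ_of_two_le {a : X →₀ ℕ} (hj : 2 ≤ a j) (i : ℕ) :
    F.scalarComplex.ExactAt (box a Finset.univ) i := by
  rw [← Finset.insert_erase (Finset.mem_univ j)]
  exact exactAt_box_of_two_le F hj (Finset.notMem_erase _ _) i

end FaceStrands

/-! ### Sign conditions on a space of functions. -/

section Arrangement

variable {U : Type*}

/-- Some function of the subspace `M` has the prescribed signs on `t` and vanishes on `R`. -/
def Meets (M : Submodule ℝ (U → ℝ)) (t : Finset (U × ℤˣ)) (R : Finset U) : Prop :=
  ∃ p ∈ M, (∀ x ∈ t, 0 < ((x.2 : ℤ) : ℝ) * p x.1) ∧ ∀ u ∈ R, p u = 0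

variable {M : Submodule ℝ (U → ℝ)} {t t' : Finset (U × ℤˣ)} {R R' : Finset U} {u : U} {v : ℤˣ}

lemma Meets.mono (h : Meets M t R) (ht : t' ⊆ t) (hR : R' ⊆ R) : Meets M t' R' := by
  obtain ⟨p, hp, hpt, hpR⟩ := h
  exact ⟨p, hp, fun x hx => hpt x (ht hx), fun u hu => hpR u (hR hu)⟩

lemma exists_perturbation {p : U → ℝ} (hp : ∀ x ∈ t, 0 < ((x.2 : ℤ) : ℝ) * p x.1)
    (q : U → ℝ) : ∃ ε : ℝ, 0 < ε ∧ (∀ x ∈ t, 0 < ((x.2 : ℤ) : ℝ) * (p + ε • q) x.1) ∧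
      ∀ x ∈ t, 0 < ((x.2 : ℤ) : ℝ) * (p + (-ε) • q) x.1 := by
  have h : ∀ᶠ ε : ℝ in nhds 0, ∀ x ∈ t, 0 < ((x.2 : ℤ) : ℝ) * (p + ε • q) x.1 := by
    rw [Filter.eventually_all_finset]
    intro x hx
    have hc : Continuous fun ε : ℝ => ((x.2 : ℤ) : ℝ) * (p + ε • q) x.1 := by
      simp only [Pi.add_apply, Pi.smul_apply, smul_eq_mul]
      fun_prop
    refine hc.continuousAt.eventually_const_lt ?_
    simpa using hp x hx
  obtain ⟨δ, hδ, hball⟩ := Metric.eventually_nhds_iff.1 h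
  refine ⟨δ / 2, by positivity, hball ?_, hball ?_⟩
  · rw [dist_zero_right, Real.norm_eq_abs, abs_of_pos (by positivity)]; linarith
  · rw [dist_zero_right, norm_neg, Real.norm_eq_abs, abs_of_pos (by positivity)]; linarith

lemma exists_sign_mul_pos {r : ℝ} (hr : r ≠ 0) : ∃ v : ℤˣ, 0 < ((v : ℤ) : ℝ) * r := by
  rcases lt_or_gt_of_ne hr with h | h
  · exact ⟨-1, by simpa using h⟩
  · exact ⟨1, by simpa using h⟩

/-- Both sign choices at the points of `R`. -/
def signPairs (R : Finset U) : Finset (U × ℤˣ) := R ×ˢ Finset.univ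

lemma mem_signPairs {x : U × ℤˣ} : x ∈ signPairs R ↔ x.1 ∈ R := by
  rw [signPairs, Finset.mem_product, and_iff_left (Finset.mem_univ _)]

/-- The functions of the subspace `M` which vanish on `R`. -/
def vanishing (M : Submodule ℝ (U → ℝ)) (R : Finset U) : Submodule ℝ (U → ℝ) where
  carrier := {p | p ∈ M ∧ ∀ u ∈ R, p u = 0}
  add_mem' := fun hp hq => ⟨M.add_mem hp.1 hq.1, fun u hu => by simp [hp.2 u hu, hq.2 u hu]⟩
  zero_mem' := ⟨M.zero_mem, fun _ _ => rfl⟩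
  smul_mem' := fun c _ hp => ⟨M.smul_mem c hp.1, fun u hu => by simp [hp.2 u hu]⟩

lemma vanishing_univ [Fintype U] : vanishing M (Finset.univ : Finset U) = ⊥ :=
  (Submodule.eq_bot_iff _).2 fun _ hp => funext fun u => hp.2 u (Finset.mem_univ u)

variable [DecidableEq U]

lemma meets_insert_iff : Meets M (insert (u, v) t) R ↔ ∃ p ∈ M,
    0 < ((v : ℤ) : ℝ) * p u ∧ (∀ x ∈ t, 0 < ((x.2 : ℤ) : ℝ) * p x.1) ∧ ∀ u ∈ R, p u = 0 := by
  simp only [Meets, Finset.forall_mem_insert, and_assoc]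

lemma meets_insert_zero_iff : Meets M t (insert u R) ↔ ∃ p ∈ M,
    (∀ x ∈ t, 0 < ((x.2 : ℤ) : ℝ) * p x.1) ∧ p u = 0 ∧ ∀ u ∈ R, p u = 0 := by
  simp only [Meets, Finset.forall_mem_insert]

/-- Strict signs survive a small perturbation, so a zero at `u` can be moved to either side along
`q` without disturbing the zeros on `R`. -/
lemma Meets.insert_of_zero (h : Meets M t (insert u R))
    {q : U → ℝ} (hq : q ∈ M) (hqR : ∀ u ∈ R, q u = 0) (hqu : q u ≠ 0) (v : ℤˣ) :
    Meets M (insert (u, v) t) R := by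
  obtain ⟨p, hp, hpt, hpu, hpR⟩ := meets_insert_zero_iff.1 h
  obtain ⟨ε, hε, h1, h2⟩ := exists_perturbation hpt q
  obtain ⟨w, hw⟩ := exists_sign_mul_pos hqu
  rw [meets_insert_iff]
  by_cases hvw : v = w
  · subst hvw
    refine ⟨p + ε • q, M.add_mem hp (M.smul_mem _ hq), ?_, h1, fun u hu => ?_⟩
    · simp only [Pi.add_apply, hpu, Pi.smul_apply, smul_eq_mul]
      have := mul_pos hε hw
      linarith
    · simp [hpR u hu, hqR u hu]
  · have hv : v = -w := by
      rcases Int.units_eq_one_or v with rfl | rfl <;> rcases Int.units_eq_one_or w with rfl | rfl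
        <;> simp_all
    subst hv
    refine ⟨p + (-ε) • q, M.add_mem hp (M.smul_mem _ hq), ?_, h2, fun u hu => ?_⟩
    · simp only [Pi.add_apply, hpu, Pi.smul_apply, smul_eq_mul, Units.val_neg, Int.cast_neg]
      have := mul_pos hε hw
      linarith
    · simp [hpR u hu, hqR u hu]

lemma meets_zero_of_opposite (h1 : Meets M (insert (u, v) t) R)
    (h2 : Meets M (insert (u, -v) t) R) : Meets M t (insert u R) := by
  obtain ⟨p, hp, hpu, hpt, hpR⟩ := meets_insert_iff.1 h1
  obtain ⟨q, hq, hqu, hqt, hqR⟩ := meets_insert_iff.1 h2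
  rw [meets_insert_zero_iff]
  -- The positive weights are the absolute values at `u`, exchanged between `p` and `q`, so that the
  -- combination cancels at `u` and keeps the signs on `t`.
  set α := ((v : ℤ) : ℝ) * p u with hα
  set β := (((-v : ℤˣ) : ℤ) : ℝ) * q u with hβ
  refine ⟨β • p + α • q, M.add_mem (M.smul_mem _ hp) (M.smul_mem _ hq), fun x hx => ?_, ?_,
    fun w hw => ?_⟩
  · simp only [Pi.add_apply, Pi.smul_apply, smul_eq_mul]
    have := mul_pos hqu (hpt x hx)
    have := mul_pos hpu (hqt x hx)
    linarith
  · simp only [Pi.add_apply, Pi.smul_apply, smul_eq_mul, hα, hβ, Units.val_neg, Int.cast_neg]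
    ring
  · simp [hpR w hw, hqR w hw]

lemma not_meets_opposite (h : (u, v) ∈ t) : ¬ Meets M (insert (u, -v) t) R := by
  intro hm
  obtain ⟨p, -, hpu, hpt, -⟩ := meets_insert_iff.1 hm
  have := hpt _ h
  rw [Units.val_neg, Int.cast_neg] at hpu
  simp only at this
  linarith

lemma vanishing_insert_eq (h : ∀ p ∈ vanishing M R, p u = 0) :
    vanishing M (insert u R) = vanishing M R :=
  le_antisymm (fun _ hp => ⟨hp.1, fun w hw => hp.2 w (Finset.mem_insert_of_mem hw)⟩)
    fun p hp => ⟨hp.1, (Finset.forall_mem_insert _ _ _).2 ⟨h p hp, hp.2⟩⟩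

lemma finrank_vanishing_insert [Finite U] {q : U → ℝ} (hq : q ∈ vanishing M R) (hqu : q u ≠ 0) :
    Module.finrank ℝ (vanishing M (insert u R)) + 1 = Module.finrank ℝ (vanishing M R) := by
  let φ : vanishing M R →ₗ[ℝ] ℝ :=
    LinearMap.proj (φ := fun _ : U => ℝ) u ∘ₗ (vanishing M R).subtype
  have hker : vanishing M (insert u R) = (LinearMap.ker φ).map (vanishing M R).subtype := by
    ext p
    constructor
    · intro hp
      exact ⟨⟨p, hp.1, fun w hw => hp.2 w (Finset.mem_insert_of_mem hw)⟩,
        hp.2 u (Finset.mem_insert_self u R), rfl⟩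
    · rintro ⟨p, hp, rfl⟩
      exact ⟨p.2.1, (Finset.forall_mem_insert _ _ _).2 ⟨hp, p.2.2⟩⟩
  have hrange : LinearMap.range φ = ⊤ :=
    LinearMap.range_eq_top.2 (LinearMap.surjective (f := φ) fun h =>
      hqu (LinearMap.congr_fun h ⟨q, hq⟩))
  have := φ.finrank_range_add_finrank_ker
  rw [hrange, finrank_top, Module.finrank_self] at this
  rw [hker, Submodule.finrank_map_subtype_eq]
  omega

lemma signPairs_insert (v : ℤˣ) (u : U) (R : Finset U) :
    signPairs (insert u R) = insert (u, -v) (insert (u, v) (signPairs R)) := by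
  ext ⟨w, s⟩
  simp only [signPairs, Finset.mem_product, Finset.mem_insert, Finset.mem_univ, and_true,
    Prod.mk.injEq]
  have : s = -v ∨ s = v := by
    rcases Int.units_eq_one_or v with rfl | rfl <;> rcases Int.units_eq_one_or s with rfl | rfl
      <;> simp
  tauto

lemma notMem_insert_of_forall {t : Finset (U × ℤˣ)} {R : Finset U} {u : U} {v : ℤˣ}
    (hd : ∀ x ∈ t, x.1 ∉ insert u R) (hu : u ∉ R) : ∀ x ∈ insert (u, v) t, x.1 ∉ R :=
  (Finset.forall_mem_insert _ _ _).2
    ⟨hu, fun x hx h => hd x hx (Finset.mem_insert_of_mem h)⟩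

lemma not_meets_of_vanishing {t : Finset (U × ℤˣ)} {R : Finset U} {u : U}
    (hq : ∀ q ∈ vanishing M R, q u = 0) (v : ℤˣ) : ¬ Meets M (insert (u, v) t) R := by
  intro h
  obtain ⟨p, hp, hpu, -, hpR⟩ := meets_insert_iff.1 h
  rw [hq p ⟨hp, hpR⟩, mul_zero] at hpu
  exact lt_irrefl _ hpu

end Arrangement

/-! ### Homology of the complex of an arrangement. -/

section ArrangementHomology

variable {𝕜 : Type*} [Field 𝕜] {U : Type*} [Fintype U] [DecidableEq U]
  {Δ : LowerSet (Finset (U × ℤˣ))}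
  {F : MinimalGradedFreeResolution (alexanderDual (stanleyReisnerIdeal 𝕜 Δ))}
  {M : Submodule ℝ (U → ℝ)} {t₀ : Finset (U × ℤˣ)}

/-- The strand of a face is acyclic with respect to the sign pairs at `R` if no function realizing
the face vanishes on `R`; if some function realizing a larger face does, then passing to the larger
face is a quasi-isomorphism. -/
lemma faceAcyclic_signPairs_aux (hΔ : ∀ s, t₀ ⊆ s → (s ∈ Δ ↔ Meets M s ∅)) (R : Finset U) :
    (∀ t, t₀ ⊆ t → (∀ x ∈ t, x.1 ∉ R) → ¬ Meets M t R → FaceAcyclic F t (signPairs R)) ∧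
    ∀ t, t₀ ⊆ t → ∀ j, j ∉ t → (∀ x ∈ insert j t, x.1 ∉ R) → Meets M (insert j t) R →
      FaceAcyclic F t (insert j (signPairs R)) := by
  induction R using Finset.induction_on with
  | empty =>
    refine ⟨fun t ht _ hm => faceAcyclic_of_notMem (fun h => hm ((hΔ t ht).1 h)) _,
      fun t ht j hj _ hm => ?_⟩
    rw [signPairs, Finset.empty_product, insert_empty_eq]
    exact faceAcyclic_singleton hj ((hΔ _ (ht.trans (Finset.subset_insert j t))).2 hm)
  | insert u R hu ih =>
    obtain ⟨ih1, ih2⟩ := ih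
    have hsub : ∀ t (j : U × ℤˣ), t₀ ⊆ t → t₀ ⊆ insert j t :=
      fun t j ht => ht.trans (Finset.subset_insert j t)
    constructor
    · intro t ht hd hm
      have hd' : ∀ v, ∀ x ∈ insert (u, v) t, x.1 ∉ R := fun v => notMem_insert_of_forall hd hu
      have hd0 : ∀ x ∈ t, x.1 ∉ R := fun x hx h => hd x hx (Finset.mem_insert_of_mem h)
      -- The functions realizing `t` and vanishing on `R` are never zero at `u`, so by convexity
      -- they share one sign `v` there. If there are none, any `v` serves.
      obtain ⟨v, h1, h2⟩ : ∃ v : ℤˣ, FaceAcyclic F t (insert (u, v) (signPairs R)) ∧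
          ¬ Meets M (insert (u, -v) t) R := by
        by_cases hR : Meets M t R
        · obtain ⟨p, hp, hpt, hpR⟩ := hR
          have hpu : p u ≠ 0 := fun h0 =>
            hm (meets_insert_zero_iff.2 ⟨p, hp, hpt, h0, hpR⟩)
          obtain ⟨v, hv⟩ := exists_sign_mul_pos hpu
          have hmv : Meets M (insert (u, v) t) R := meets_insert_iff.2 ⟨p, hp, hv, hpt, hpR⟩
          exact ⟨v, ih2 t ht _ (fun h => hd _ h (Finset.mem_insert_self u R)) (hd' v) hmv,
            fun h => hm (meets_zero_of_opposite hmv h)⟩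
        · have hR' : ∀ v, ¬ Meets M (insert (u, v) t) R := fun v h =>
            hR (h.mono (Finset.subset_insert _ _) subset_rfl)
          exact ⟨1, (ih1 t ht hd0 hR).insert (ih1 _ (hsub _ _ ht) (hd' 1) (hR' 1)), hR' (-1)⟩
      rw [signPairs_insert v]
      refine h1.insert ((ih1 _ (hsub _ _ ht) (hd' _) h2).insert
        (faceAcyclic_of_notMem (fun h => ?_) _))
      rw [hΔ _ (hsub _ _ (hsub _ _ ht)), Finset.insert_comm] at h
      exact not_meets_opposite (Finset.mem_insert_self _ _) h
    · intro t ht j hj hd hm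
      have hju : ∀ v, j ≠ (u, v) := fun v h => by
        have := hd j (Finset.mem_insert_self j t)
        rw [h] at this
        exact this (Finset.mem_insert_self u R)
      have hd1 : ∀ x ∈ t, x.1 ∉ insert u R := fun x hx => hd x (Finset.mem_insert_of_mem hx)
      have hd' : ∀ v, ∀ x ∈ insert (u, v) t, x.1 ∉ R := fun v => notMem_insert_of_forall hd1 hu
      have hd2 : ∀ v, ∀ x ∈ insert j (insert (u, v) t), x.1 ∉ R := fun v => by
        rw [Finset.insert_comm]
        exact notMem_insert_of_forall hd hu
      -- Either some function vanishing on `R` is nonzero at `u`, and perturbation reaches both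
      -- sides, or all of them vanish at `u`, and neither side meets `R`.
      have hcell : ∀ v, FaceAcyclic F (insert (u, v) t) (insert j (signPairs R)) := by
        intro v
        have hjv : j ∉ insert (u, v) t := by
          rw [Finset.mem_insert, not_or]; exact ⟨hju v, hj⟩
        by_cases hq : ∃ q ∈ vanishing M R, q u ≠ 0
        · obtain ⟨q, hq, hqu⟩ := hq
          refine ih2 _ (hsub _ _ ht) j hjv (hd2 v) ?_
          rw [Finset.insert_comm]
          exact hm.insert_of_zero hq.1 hq.2 hqu v
        · push Not at hq
          refine (ih1 _ (hsub _ _ ht) (hd' v) (not_meets_of_vanishing hq v)).insert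
            (ih1 _ (hsub _ _ (hsub _ _ ht)) (hd2 v) ?_)
          rw [Finset.insert_comm]
          exact not_meets_of_vanishing hq v
      have h0 : FaceAcyclic F t (insert j (signPairs R)) :=
        ih2 t ht j hj (fun x hx h => hd x hx (Finset.mem_insert_of_mem h))
          (hm.mono subset_rfl (Finset.subset_insert _ _))
      rw [signPairs_insert 1, Finset.insert_comm, Finset.insert_comm j]
      refine (h0.insert (hcell 1)).insert ((hcell (-1)).insert
        (faceAcyclic_of_notMem (fun h => ?_) _))
      rw [hΔ _ (hsub _ _ (hsub _ _ ht)), Finset.insert_comm] at h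
      exact not_meets_opposite (Finset.mem_insert_self _ _) h

lemma faceAcyclic_signPairs (hΔ : ∀ s, t₀ ⊆ s → (s ∈ Δ ↔ Meets M s ∅)) {R : Finset U}
    {t : Finset (U × ℤˣ)} (ht : t₀ ⊆ t) (hd : ∀ x ∈ t, x.1 ∉ R) (hm : ¬ Meets M t R) :
    FaceAcyclic F t (signPairs R) :=
  (faceAcyclic_signPairs_aux hΔ R).1 t ht hd hm

lemma faceAcyclic_insert_signPairs (hΔ : ∀ s, t₀ ⊆ s → (s ∈ Δ ↔ Meets M s ∅)) {R : Finset U}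
    {t : Finset (U × ℤˣ)} (ht : t₀ ⊆ t) {j : U × ℤˣ} (hj : j ∉ t)
    (hd : ∀ x ∈ insert j t, x.1 ∉ R) (hm : Meets M (insert j t) R) :
    FaceAcyclic F t (insert j (signPairs R)) :=
  (faceAcyclic_signPairs_aux hΔ R).2 t ht j hj hd hm

/-- The half-spaces at `R` cover the open cone of `t` minus the functions vanishing on `R`, a
subspace of codimension `n` meeting the cone. What is left is homotopically a sphere of dimension `n
- 1`, seen in homological degree `n`, at index `n + 2`. -/
lemma faceDimOne_signPairs (hΔ : ∀ s, s ∈ Δ ↔ Meets M s ∅) {R : Finset U}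
    {t : Finset (U × ℤˣ)} {n : ℕ}
    (hn : n + Module.finrank ℝ (vanishing M R) = Module.finrank ℝ M)
    (hd : ∀ x ∈ t, x.1 ∉ R) (hm : Meets M t R) : FaceDimOne F t (signPairs R) (n + 1) := by
  have hΔ' : ∀ s, ∅ ⊆ s → (s ∈ Δ ↔ Meets M s ∅) := fun s _ => hΔ s
  induction R using Finset.induction_on generalizing t n with
  | empty =>
    have h0 : vanishing M ∅ = M :=
      le_antisymm (fun p hp => hp.1) fun p hp => ⟨hp, fun u hu => absurd hu (Finset.notMem_empty u)⟩
    rw [h0] at hn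
    obtain rfl : n = 0 := by omega
    rw [signPairs, Finset.empty_product]
    exact faceDimOne_empty ((hΔ t).2 hm)
  | insert u R hu ih =>
    have hd' : ∀ v, ∀ x ∈ insert (u, v) t, x.1 ∉ R := fun v => notMem_insert_of_forall hd hu
    have hd0 : ∀ x ∈ t, x.1 ∉ R := fun x hx h => hd x hx (Finset.mem_insert_of_mem h)
    have hut : ∀ v, (u, v) ∉ t := fun v h => hd _ h (Finset.mem_insert_self u R)
    have hopp : ∀ L, FaceAcyclic F (insert (u, 1) (insert (u, -1) t)) L := fun L =>
      faceAcyclic_of_notMem (fun h => not_meets_opposite (Finset.mem_insert_self _ _)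
        (by rw [Finset.insert_comm] at h; exact (hΔ _).1 h)) L
    have hm0 : Meets M t R := hm.mono subset_rfl (Finset.subset_insert _ _)
    rw [signPairs_insert 1]
    by_cases hq : ∃ q ∈ vanishing M R, q u ≠ 0
    · obtain ⟨q, hq, hqu⟩ := hq
      have hfr := finrank_vanishing_insert hq hqu
      obtain ⟨m, rfl⟩ : ∃ m, n = m + 1 := by
        have : Module.finrank ℝ (vanishing M R) ≤ Module.finrank ℝ M :=
          Submodule.finrank_mono fun p hp => hp.1
        exact ⟨n - 1, by omega⟩
      have hmv := hm.insert_of_zero hq.1 hq.2 hqu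
      -- The codimension grows by one and the sphere is suspended: without `(u, -1)` the complex is
      -- acyclic, and the link of `(u, -1)` is the previous sphere.
      refine FaceDimOne.insert_succ ?_ ?_ (hut _) ?_
      · exact (ih (by omega) (hd' _) (hmv _)).insert (hopp _)
      · exact faceAcyclic_insert_signPairs hΔ' (Finset.empty_subset _) (hut _) (hd' _) (hmv _)
      · rw [Finset.mem_insert, mem_signPairs, not_or]
        exact ⟨by simp, hu⟩
    · push Not at hq
      rw [vanishing_insert_eq hq] at hn
      have hac : ∀ v, FaceAcyclic F (insert (u, v) t) (signPairs R) := fun v =>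
        faceAcyclic_signPairs hΔ' (Finset.empty_subset _) (hd' v) (not_meets_of_vanishing hq v)
      exact ((ih hn hd0 hm0).insert (hac 1)).insert ((hac (-1)).insert (hopp _))

/-- The bound holds for every `t`, realizable on `R` or not: the homological degree rises by at most
one each time the codimension does. -/
lemma faceExactAt_signPairs (hΔ : ∀ s, s ∈ Δ ↔ Meets M s ∅) {R : Finset U}
    {t : Finset (U × ℤˣ)} {n i : ℕ}
    (hn : n + Module.finrank ℝ (vanishing M R) = Module.finrank ℝ M)
    (hd : ∀ x ∈ t, x.1 ∉ R) (hi : n < i) : FaceExactAt F t (signPairs R) (i + 1) := by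
  have hΔ' : ∀ s, ∅ ⊆ s → (s ∈ Δ ↔ Meets M s ∅) := fun s _ => hΔ s
  induction R using Finset.induction_on generalizing t n i with
  | empty =>
    obtain ⟨m, rfl⟩ : ∃ m, i = m + 1 := ⟨i - 1, by omega⟩
    rw [signPairs, Finset.empty_product]
    exact faceExactAt_empty t m
  | insert u R hu ih =>
    have hd' : ∀ v, ∀ x ∈ insert (u, v) t, x.1 ∉ R := fun v => notMem_insert_of_forall hd hu
    have hd0 : ∀ x ∈ t, x.1 ∉ R := fun x hx h => hd x hx (Finset.mem_insert_of_mem h)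
    have hopp : ∀ L, FaceAcyclic F (insert (u, 1) (insert (u, -1) t)) L := fun L =>
      faceAcyclic_of_notMem (fun h => not_meets_opposite (Finset.mem_insert_self _ _)
        (by rw [Finset.insert_comm] at h; exact (hΔ _).1 h)) L
    rw [signPairs_insert 1]
    obtain ⟨m, rfl⟩ : ∃ m, i = m + 1 := ⟨i - 1, by omega⟩
    by_cases hq : ∃ q ∈ vanishing M R, q u ≠ 0
    · obtain ⟨_, hq, hqu⟩ := hq
      have hfr := finrank_vanishing_insert hq hqu
      have hle : Module.finrank ℝ (vanishing M R) ≤ Module.finrank ℝ M :=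
        Submodule.finrank_mono fun p hp => hp.1
      obtain ⟨l, rfl⟩ : ∃ l, m = l + 1 := ⟨m - 1, by omega⟩
      have h1 : FaceExactAt F t (signPairs R) (l + 1 + 1 + 1) :=
        ih (n := n - 1) (by omega) hd0 (by omega)
      have h2 : ∀ v, FaceExactAt F (insert (u, v) t) (signPairs R) (l + 1 + 1) := fun v =>
        ih (n := n - 1) (by omega) (hd' v) (by omega)
      exact (h1.insert (h2 1)).insert ((h2 (-1)).insert (hopp _ _))
    · push Not at hq
      rw [vanishing_insert_eq hq] at hn
      have hac : ∀ v, FaceAcyclic F (insert (u, v) t) (signPairs R) := fun v =>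
        faceAcyclic_signPairs hΔ' (Finset.empty_subset _) (hd' v) (not_meets_of_vanishing hq v)
      exact ((ih hn hd0 hi).insert (hac 1 _)).insert ((hac (-1)).insert (hopp _) _)

/-- The points of `U` at which `t` prescribes no sign. -/
def freePoints (t : Finset (U × ℤˣ)) : Finset U :=
  (t.image Prod.fst)ᶜ

lemma notMem_freePoints {t : Finset (U × ℤˣ)} : ∀ x ∈ t, x.1 ∉ freePoints t := fun _ hx h =>
  Finset.mem_compl.1 h (Finset.mem_image_of_mem _ hx)

/-- Over a point where `t` fixes a sign, one vertex lies in `t` and the opposite one is incompatible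
with it; only free points matter. -/
lemma FaceExactAt.univ_of_signPairs {t : Finset (U × ℤˣ)} {i : ℕ}
    (hΔ : ∀ s, t ⊆ s → (s ∈ Δ ↔ Meets M s ∅))
    (h : FaceExactAt F t (signPairs (freePoints t)) (i + 1)) :
    FaceExactAt F t Finset.univ (i + 1) := by
  rw [← Finset.union_compl (signPairs (freePoints t))]
  refine h.union fun x hx => ?_
  rw [Finset.mem_compl, mem_signPairs, freePoints, Finset.mem_compl, not_not,
    Finset.mem_image] at hx
  obtain ⟨y, hy, hyx⟩ := hx
  by_cases hxy : x.2 = y.2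
  · exact Or.inl ((Prod.ext hyx.symm hxy : x = y) ▸ hy)
  · right
    rw [hΔ _ (Finset.subset_insert _ _)]
    have hv : x.2 = -y.2 := by
      rcases Int.units_eq_one_or x.2 with h | h <;> rcases Int.units_eq_one_or y.2 with h' | h'
        <;> simp_all
    have hx' : x = (y.1, -y.2) := Prod.ext hyx.symm hv
    rw [hx']
    exact not_meets_opposite hy

lemma faceDimOne_univ (hΔ : ∀ s, s ∈ Δ ↔ Meets M s ∅) :
    FaceDimOne F ∅ Finset.univ (Module.finrank ℝ M + 1) := by
  have huniv : (Finset.univ : Finset (U × ℤˣ)) = signPairs Finset.univ := by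
    ext x; simp [mem_signPairs]
  rw [huniv]
  refine faceDimOne_signPairs hΔ ?_ (by simp) ⟨0, M.zero_mem, by simp, by simp⟩
  rw [vanishing_univ, finrank_bot, add_zero]

lemma faceExactAt_univ (hΔ : ∀ s, s ∈ Δ ↔ Meets M s ∅) (t : Finset (U × ℤˣ)) {i : ℕ}
    (hi : Module.finrank ℝ M < i) : FaceExactAt F t Finset.univ (i + 1) := by
  refine FaceExactAt.univ_of_signPairs (M := M) (fun s _ => hΔ s) ?_
  have hle : Module.finrank ℝ (vanishing M (freePoints t)) ≤ Module.finrank ℝ M :=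
    Submodule.finrank_mono fun p hp => hp.1
  exact faceExactAt_signPairs hΔ
    (n := Module.finrank ℝ M - Module.finrank ℝ (vanishing M (freePoints t)))
    (by omega) notMem_freePoints (by omega)

variable (F) in
lemma multiplicity_eq_zero_of_finrank_lt (hΔ : ∀ s, s ∈ Δ ↔ Meets M s ∅) {i : ℕ}
    (hi : Module.finrank ℝ M < i) (a : U × ℤˣ →₀ ℕ) : F.multiplicity i a = 0 := by
  refine F.multiplicity_eq_zero ?_
  by_cases ha : ∃ j, 2 ≤ a j
  · obtain ⟨j, hj⟩ := ha
    exact exactAt_box_univ_of_two_le F hj _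
  · push Not at ha
    have : a = squarefreeExp (Finset.univ.filter fun j => a j = 0)ᶜ := by
      ext j
      have := ha j
      rw [squarefreeExp_apply]
      simp only [Finset.compl_filter, Finset.mem_filter, Finset.mem_univ, true_and]
      split_ifs with h <;> omega
    rw [this]
    exact faceExactAt_univ hΔ _ hi

/-- Adding to the complex of an arrangement the graph of a function orthogonal to all the functions
of the arrangement makes it acyclic. -/
lemma faceAcyclic_univ_of_orthogonal [Nonempty U] {f : U → ℤˣ}
    (hf : ∀ p ∈ M, ∑ u, ((f u : ℤ) : ℝ) * p u = 0)
    (hΔ : ∀ s, s ∈ Δ ↔ Meets M s ∅ ∨ ∀ x ∈ s, f x.1 = x.2) :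
    FaceAcyclic F ∅ Finset.univ := by
  set P : Finset (U × ℤˣ) := Finset.univ.filter fun x => f x.1 = x.2 with hP
  have hPc : ∀ x, x ∈ Pᶜ ↔ f x.1 ≠ x.2 := fun x => by simp [hP]
  -- A face with a vertex off the graph of `f` must come from the arrangement.
  have hlink : ∀ x, x ∈ Pᶜ → ∀ s, x ∈ s → (s ∈ Δ ↔ Meets M s ∅) := fun x hx s hs => by
    rw [hΔ, or_iff_left]
    exact fun h => (hPc x).1 hx (h x hs)
  -- A function with the signs of `t` and zero at the free points would make all terms of the
  -- orthogonality sum nonpositive and one negative.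
  have hfull : ∀ t ⊆ Pᶜ, t.Nonempty → FaceAcyclic F t Finset.univ := by
    rintro t ht ⟨x, hx⟩
    have hΔt : ∀ s, t ⊆ s → (s ∈ Δ ↔ Meets M s ∅) := fun s hs => hlink x (ht hx) s (hs hx)
    have hac : FaceAcyclic F t (signPairs (freePoints t)) := by
      refine faceAcyclic_signPairs hΔt subset_rfl notMem_freePoints ?_
      rintro ⟨p, hp, hpt, hp0⟩
      have hneg : ∀ y ∈ t, ((f y.1 : ℤ) : ℝ) * p y.1 < 0 := fun y hy => by
        have h1 := hpt y hy
        have h2 := (hPc y).1 (ht hy)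
        have h3 : y.2 = - f y.1 := by
          rcases Int.units_eq_one_or y.2 with h | h <;>
            rcases Int.units_eq_one_or (f y.1) with h' | h' <;> simp_all
        rw [h3, Units.val_neg, Int.cast_neg] at h1
        linarith
      have hnonpos : ∀ u ∈ Finset.univ, ((f u : ℤ) : ℝ) * p u ≤ 0 := fun u _ => by
        by_cases hu : u ∈ freePoints t
        · rw [hp0 u hu, mul_zero]
        · rw [freePoints, Finset.mem_compl, not_not, Finset.mem_image] at hu
          obtain ⟨y, hy, rfl⟩ := hu
          exact (hneg y hy).le
      exact (hneg x hx).ne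
        ((Finset.sum_eq_zero_iff_of_nonpos hnonpos).1 (hf p hp) x.1 (Finset.mem_univ _))
    intro i
    cases i with
    | zero => exact F.exactAt_zero _
    | succ i => exact FaceExactAt.univ_of_signPairs hΔt (hac _)
  -- The links stay acyclic when vertices off the graph are deleted, because the link of `insert e
  -- t` is acyclic too.
  have hdel : ∀ E ⊆ Pᶜ, ∀ t ⊆ Pᶜ, t.Nonempty → FaceAcyclic F t (Finset.univ \ E) := by
    intro E
    induction E using Finset.induction_on with
    | empty => intro _ t ht hne; rw [Finset.sdiff_empty]; exact hfull t ht hne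
    | insert e E he ih =>
      intro hE t ht hne
      have ih' := ih ((Finset.subset_insert e E).trans hE)
      have hins : Finset.univ \ E = insert e (Finset.univ \ insert e E) := by
        ext y
        simp only [Finset.mem_sdiff, Finset.mem_univ, true_and, Finset.mem_insert, not_or]
        by_cases hy : y = e
        · subst hy; simp [he]
        · simp [hy]
      rw [hins] at ih'
      have hmem : ∀ t ⊆ Pᶜ, e ∈ t → FaceAcyclic F t (Finset.univ \ insert e E) := by
        intro t ht het i
        have hi := ih' t ht ⟨e, het⟩ i
        rwa [FaceExactAt, box_compl_insert_of_mem het] at hi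
      exact (ih' t ht hne).of_insert (hmem (insert e t)
        (Finset.insert_subset (hE (Finset.mem_insert_self e E)) ht) (Finset.mem_insert_self e t))
  -- Start from the simplex `P`; each new vertex is attached along its acyclic link in the complex
  -- built so far.
  have hadd : ∀ N ⊆ Pᶜ, FaceAcyclic F ∅ (P ∪ N) := by
    intro N
    induction N using Finset.induction_on with
    | empty =>
      intro _
      obtain ⟨u⟩ := ‹Nonempty U›
      have hu : (u, f u) ∈ P := by simp [hP]
      rw [Finset.union_empty, ← Finset.insert_erase hu]
      refine faceAcyclic_simplex (Finset.notMem_empty _) (Finset.notMem_erase _ _) ?_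
      rw [Finset.empty_union, Finset.insert_erase hu, hΔ]
      exact Or.inr fun x hx => (Finset.mem_filter.1 hx).2
    | insert e N _ ih =>
      intro hN
      rw [Finset.union_insert]
      refine (ih ((Finset.subset_insert e N).trans hN)).insert ?_
      have := hdel (P ∪ N)ᶜ (Finset.compl_subset_compl.2 Finset.subset_union_left) {e}
        (Finset.singleton_subset_iff.2 (hN (Finset.mem_insert_self e N))) ⟨e, by simp⟩
      rwa [← Finset.compl_eq_univ_sdiff, compl_compl] at this
  have := hadd Pᶜ subset_rfl
  rwa [Finset.union_compl] at this

end ArrangementHomology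

/-! ### Walsh characters and polynomials on the cube. -/

section Cube

variable {d : ℕ}

/-- The points of the cube as real vectors. -/
def cubePoint (u : Fin d → ℤˣ) : Fin d → ℝ := fun i => ((u i : ℤ) : ℝ)

/-- The functions on the cube given by the real polynomials of degree at most `k`. -/
def polyFunctions (d k : ℕ) : Submodule ℝ ((Fin d → ℤˣ) → ℝ) :=
  (restrictTotalDegree (Fin d) ℝ k).map
    (LinearMap.pi fun u => (aeval (cubePoint u)).toLinearMap)

lemma mem_polyFunctions {k : ℕ} {q : (Fin d → ℤˣ) → ℝ} :
    q ∈ polyFunctions d k ↔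
      ∃ p : MvPolynomial (Fin d) ℝ, p.totalDegree ≤ k ∧ ∀ u, eval (cubePoint u) p = q u := by
  simp only [polyFunctions, Submodule.mem_map, mem_restrictTotalDegree, funext_iff,
    LinearMap.pi_apply, AlgHom.toLinearMap_apply, aeval_eq_eval]

/-- The Walsh character of the cube associated with a set of coordinates. -/
def walsh (s : Finset (Fin d)) : (Fin d → ℤˣ) →* ℝ where
  toFun u := ∏ i ∈ s, ((u i : ℤ) : ℝ)
  map_one' := by simp
  map_mul' u v := by simp [Finset.prod_mul_distrib]

lemma walsh_apply (s : Finset (Fin d)) (u : Fin d → ℤˣ) :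
    walsh s u = ∏ i ∈ s, ((u i : ℤ) : ℝ) := rfl

/-- The point with a single `-1`, in coordinate `j`, detects whether `j ∈ s`. -/
lemma walsh_injective : Function.Injective (walsh (d := d)) := by
  intro s t h
  ext j
  have hj := DFunLike.congr_fun h (Function.update (1 : Fin d → ℤˣ) j (-1))
  have key : ∀ s : Finset (Fin d), walsh s (Function.update (1 : Fin d → ℤˣ) j (-1)) = if j ∈ s then -1 else 1 := by
    intro s
    rw [walsh_apply, Finset.prod_congr rfl (g := fun i => if i = j then (-1 : ℝ) else 1)]
    · simp
    · intro i _
      by_cases hi : i = j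
      · subst hi; simp
      · simp [hi]
  rw [key, key] at hj
  split_ifs at hj with h1 h2 h2
  · simp [h1, h2]
  · norm_num at hj
  · norm_num at hj
  · simp [h1, h2]

lemma linearIndependent_walsh :
    LinearIndependent ℝ fun s : Finset (Fin d) => (walsh s : (Fin d → ℤˣ) → ℝ) :=
  (linearIndependent_monoidHom (Fin d → ℤˣ) ℝ).comp _ walsh_injective

/-- The product is a nontrivial character of a finite group, and such a character sums to zero. -/
lemma sum_walsh_mul_walsh {s t : Finset (Fin d)} (h : s ≠ t) :
    ∑ u, walsh s u * walsh t u = 0 := by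
  classical
  have hne : walsh s * walsh t ≠ 1 := by
    intro h1
    refine h (walsh_injective (MonoidHom.ext fun u => ?_))
    have h2 : walsh t u * walsh t u = 1 := by
      rw [walsh_apply, ← Finset.prod_mul_distrib]
      refine Finset.prod_eq_one fun i _ => ?_
      rcases Int.units_eq_one_or (u i) with h | h <;> simp [h]
    have h3 : walsh s u * walsh t u = 1 := DFunLike.congr_fun h1 u
    calc walsh s u = walsh s u * (walsh t u * walsh t u) := by rw [h2, mul_one]
      _ = walsh t u := by rw [← mul_assoc, h3, one_mul]
  exact sum_hom_units_eq_zero (walsh s * walsh t) hne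

lemma eval_monomial_cubePoint (m : Fin d →₀ ℕ) (u : Fin d → ℤˣ) :
    eval (cubePoint u) (monomial m (1 : ℝ))
      = walsh (Finset.univ.filter fun i => Odd (m i)) u := by
  rw [eval_monomial, one_mul, Finsupp.prod_fintype _ _ (by simp), walsh_apply,
    Finset.prod_filter]
  refine Finset.prod_congr rfl fun i _ => ?_
  rw [cubePoint]
  split_ifs with h
  · rcases Int.units_eq_one_or (u i) with hu | hu
    · simp [hu]
    · simp [hu, h.neg_one_pow]
  · rw [Nat.not_odd_iff_even] at h
    rcases Int.units_eq_one_or (u i) with hu | hu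
    · simp [hu]
    · simp [hu, h.neg_one_pow]

/-- On the cube squares are `1`, so a monomial depends only on the set of its odd exponents, which
is no larger than its degree. -/
lemma polyFunctions_eq_span (d k : ℕ) : polyFunctions d k = Submodule.span ℝ
    (Set.range fun s : {s : Finset (Fin d) // s.card ≤ k} =>
      (walsh s.1 : (Fin d → ℤˣ) → ℝ)) := by
  refine le_antisymm ?_ (Submodule.span_le.2 ?_)
  · intro q hq
    obtain ⟨p, hp, hpq⟩ := mem_polyFunctions.1 hq
    have hq' : q = ∑ m ∈ p.support, coeff m p •
        (walsh (Finset.univ.filter fun i => Odd (m i)) : (Fin d → ℤˣ) → ℝ) := by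
      funext u
      rw [← hpq u, Finset.sum_apply]
      conv_lhs => rw [p.as_sum, map_sum]
      refine Finset.sum_congr rfl fun m _ => ?_
      rw [Pi.smul_apply, smul_eq_mul, ← eval_monomial_cubePoint, ← mul_one (coeff m p),
        ← smul_eq_mul (coeff m p) 1, ← smul_monomial, smul_eval, smul_eq_mul, mul_one]
    rw [hq']
    refine Submodule.sum_mem _ fun m hm => Submodule.smul_mem _ _ (Submodule.subset_span ?_)
    refine ⟨⟨Finset.univ.filter fun i => Odd (m i), ?_⟩, rfl⟩
    refine le_trans ?_ ((le_totalDegree hm).trans hp)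
    rw [Finsupp.sum_fintype _ _ (fun _ => rfl), Finset.card_filter]
    refine Finset.sum_le_sum fun i _ => ?_
    split_ifs with h
    · exact h.pos
    · exact Nat.zero_le _
  · rintro _ ⟨⟨s, hs⟩, rfl⟩
    refine mem_polyFunctions.2 ⟨∏ i ∈ s, X i, ?_, fun u => ?_⟩
    · refine (totalDegree_finsetProd _ _).trans ?_
      simpa using hs
    · rw [map_prod]
      simp only [eval_X]
      rfl

lemma finrank_polyFunctions (d k : ℕ) :
    Module.finrank ℝ (polyFunctions d k) = ∑ j ∈ Finset.range (k + 1), d.choose j := by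
  classical
  have hli : LinearIndependent ℝ fun s : {s : Finset (Fin d) // s.card ≤ k} =>
      (walsh s.1 : (Fin d → ℤˣ) → ℝ) :=
    linearIndependent_walsh.comp _ Subtype.val_injective
  rw [polyFunctions_eq_span, finrank_span_eq_card hli, Fintype.card_subtype]
  have : (Finset.univ.filter fun s : Finset (Fin d) => s.card ≤ k)
      = (Finset.range (k + 1)).biUnion fun j => Finset.powersetCard j Finset.univ := by
    ext s
    simp [Finset.mem_powersetCard]
  rw [this, Finset.card_biUnion]
  · simp
  · intro i _ j _ hij
    rw [Function.onFun, Finset.disjoint_left]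
    intro s hs ht
    rw [Finset.mem_powersetCard] at hs ht
    exact hij (hs.2.symm.trans ht.2)

lemma parity_eq_walsh (u : Fin d → ℤˣ) :
    ((parity d u : ℤ) : ℝ) = walsh Finset.univ u := by
  simp [parity, walsh_apply]

lemma sum_parity_mul_eq_zero {k : ℕ} (hk : k < d) {q : (Fin d → ℤˣ) → ℝ}
    (hq : q ∈ polyFunctions d k) : ∑ u, ((parity d u : ℤ) : ℝ) * q u = 0 := by
  rw [polyFunctions_eq_span] at hq
  induction hq using Submodule.span_induction with
  | mem q hq =>
    obtain ⟨⟨s, hs⟩, rfl⟩ := hq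
    simp only [parity_eq_walsh]
    refine sum_walsh_mul_walsh fun h => ?_
    subst h
    rw [Finset.card_univ, Fintype.card_fin] at hs
    omega
  | zero => simp
  | add p q _ _ hp hq => simp only [Pi.add_apply, mul_add, Finset.sum_add_distrib, hp, hq, add_zero]
  | smul c q _ hq =>
    simp only [Pi.smul_apply, smul_eq_mul, mul_left_comm _ c, ← Finset.mul_sum, hq, mul_zero]

lemma eq_sign_iff {v : ℤˣ} {r : ℝ} : ((v : ℤ) : ℝ) = Real.sign r ↔ 0 < ((v : ℤ) : ℝ) * r := by
  rcases Int.units_eq_one_or v with rfl | rfl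
  · rcases lt_trichotomy r 0 with h | h | h
    · norm_num [Real.sign_of_neg h, h.le]
    · simp [h]
    · simp [Real.sign_of_pos h, h]
  · rcases lt_trichotomy r 0 with h | h | h
    · simp [Real.sign_of_neg h, h]
    · simp [h]
    · norm_num [Real.sign_of_pos h, h.le]

lemma mem_polythr_iff {k : ℕ} {f : (Fin d → ℤˣ) → ℤˣ} :
    f ∈ polythr d k ↔ ∃ q ∈ polyFunctions d k, ∀ u, 0 < ((f u : ℤ) : ℝ) * q u := by
  constructor
  · rintro ⟨p, hp, hf⟩
    refine ⟨fun u => eval (cubePoint u) p, mem_polyFunctions.2 ⟨p, hp, fun _ => rfl⟩, fun u => ?_⟩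
    exact eq_sign_iff.1 (hf u)
  · rintro ⟨q, hq, hf⟩
    obtain ⟨p, hp, hpq⟩ := mem_polyFunctions.1 hq
    refine ⟨p, hp, fun u => eq_sign_iff.2 ?_⟩
    change 0 < ((f u : ℤ) : ℝ) * eval (cubePoint u) p
    rw [hpq u]
    exact hf u

lemma one_mem_polyFunctions (d k : ℕ) : (1 : (Fin d → ℤˣ) → ℝ) ∈ polyFunctions d k :=
  mem_polyFunctions.2 ⟨1, by simp, fun _ => by simp⟩

/-- A polynomial with the right signs on `s` may vanish elsewhere; adding a small positive constant,
which does not raise the degree bound, makes it nowhere zero and keeps the signs on `s`. -/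
lemma mem_canonicalSuboplex_polythr_iff {k : ℕ} {s : Finset ((Fin d → ℤˣ) × ℤˣ)} :
    s ∈ canonicalSuboplex (polythr d k) ↔ Meets (polyFunctions d k) s ∅ := by
  constructor
  · rintro ⟨f, hf, hs⟩
    obtain ⟨q, hq, hfq⟩ := mem_polythr_iff.1 hf
    refine ⟨q, hq, fun x hx => ?_, by simp⟩
    rw [← hs x hx]
    exact hfq x.1
  · rintro ⟨p, hp, hps, -⟩
    have hev : ∀ᶠ ε : ℝ in nhdsWithin 0 (Set.Ioi 0),
        (∀ x ∈ s, 0 < ((x.2 : ℤ) : ℝ) * (p x.1 + ε)) ∧ ∀ u, p u + ε ≠ 0 := by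
      refine Filter.Eventually.and ?_ ?_
      · rw [Filter.eventually_all_finset]
        intro x hx
        have hc : Continuous fun ε : ℝ => ((x.2 : ℤ) : ℝ) * (p x.1 + ε) := by fun_prop
        refine (hc.continuousAt.eventually_const_lt ?_).filter_mono nhdsWithin_le_nhds
        simpa using hps x hx
      · rw [Filter.eventually_all]
        intro u
        by_cases hu : p u = 0
        · filter_upwards [self_mem_nhdsWithin] with ε hε
          rw [hu, zero_add]
          exact ne_of_gt hε
        · have hc : Continuous fun ε : ℝ => p u + ε := by fun_prop
          exact (hc.continuousAt.eventually_ne (by simpa using hu)).filter_mono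
            nhdsWithin_le_nhds
    obtain ⟨ε, hεs, hε⟩ := hev.exists
    choose f hf using fun u => exists_sign_mul_pos (hε u)
    refine ⟨f, mem_polythr_iff.2 ⟨p + ε • 1, Submodule.add_mem _ hp
      (Submodule.smul_mem _ _ (one_mem_polyFunctions d k)), fun u => by simpa using hf u⟩, ?_⟩
    intro x hx
    have h1 := hf x.1
    have h2 := hεs x hx
    rcases Int.units_eq_one_or (f x.1) with h | h <;>
      rcases Int.units_eq_one_or x.2 with h' | h' <;>
      rw [h] at h1 ⊢ <;> rw [h'] at h2 ⊢ <;> push_cast at h1 h2 <;> exfalso <;> linarith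

end Cube

/-! ### The theorem. -/

section Main

lemma gammaExp_emptyPFun {U V : Type*} [Fintype U] [Fintype V] [DecidableEq (U × V)] :
    gammaExp (emptyPFun U V) = squarefreeExp (∅ : Finset (U × V))ᶜ := by
  rw [gammaExp, Finset.compl_empty]
  congr 1
  ext x
  simp [emptyPFun, PFun.graph]

lemma nonempty_resolution_canonicalIdeal (𝕜 : Type*) [Field 𝕜] {U V : Type*} [Fintype U]
    [Fintype V] (C : Set (U → V)) :
    Nonempty (MinimalGradedFreeResolution (canonicalIdeal 𝕜 C)) :=
  exists_minimalGradedFreeResolution _ fun _ hp a => monomial_coeff_mem_alexanderDual hp a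

lemma mem_canonicalSuboplex_union_singleton {U V : Type*} {C : Set (U → V)} {f : U → V}
    {s : Finset (U × V)} : s ∈ canonicalSuboplex (C ∪ {f}) ↔
      s ∈ canonicalSuboplex C ∨ ∀ x ∈ s, f x.1 = x.2 := by
  constructor
  · rintro ⟨g, hg | rfl, h⟩
    · exact Or.inl ⟨g, hg, h⟩
    · exact Or.inr h
  · rintro (⟨g, hg, h⟩ | h)
    · exact ⟨g, Or.inl hg, h⟩
    · exact ⟨f, Or.inr rfl, h⟩

/-- A polynomial representing parity would have a positive sum against it, contradicting
orthogonality. -/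
lemma parity_notMem_polythr {d k : ℕ} (hk : k < d) : parity d ∉ polythr d k := by
  intro h
  obtain ⟨q, hq, hpos⟩ := mem_polythr_iff.1 h
  have := Finset.sum_pos (fun u _ => hpos u) Finset.univ_nonempty
  rw [sum_parity_mul_eq_zero hk hq] at this
  exact lt_irrefl _ this

theorem mainTheorem3 (𝕜 : Type*) [Field 𝕜] (d k : ℕ) (hk : k < d) :
    (∀ i : ℕ, HasClassBettiNumber 𝕜 (polythr d k ∪ {parity d}) i
      (emptyPFun (Fin d → ℤˣ) ℤˣ) 0) ∧
    HasClassBettiNumber 𝕜 (polythr d k) (∑ j ∈ Finset.range (k + 1), d.choose j)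
      (emptyPFun (Fin d → ℤˣ) ℤˣ) 1 ∧
    HasHomologicalDim 𝕜 (polythr d k) (∑ j ∈ Finset.range (k + 1), d.choose j) ∧
    parity d ∉ polythr d k := by
  have hone : ∀ F : MinimalGradedFreeResolution (canonicalIdeal 𝕜 (polythr d k)),
      F.multiplicity (∑ j ∈ Finset.range (k + 1), d.choose j)
        (gammaExp (emptyPFun (Fin d → ℤˣ) ℤˣ)) = 1 := fun F => by
    rw [← finrank_polyFunctions, gammaExp_emptyPFun]
    exact F.multiplicity_eq_one (faceDimOne_univ fun s => mem_canonicalSuboplex_polythr_iff)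
  refine ⟨fun i => ⟨nonempty_resolution_canonicalIdeal 𝕜 _, fun F => ?_⟩,
    ⟨nonempty_resolution_canonicalIdeal 𝕜 _, hone⟩,
    ⟨nonempty_resolution_canonicalIdeal 𝕜 _, fun F => ⟨fun h0 => ?_, fun i hi => ?_⟩⟩,
    parity_notMem_polythr hk⟩
  · rw [gammaExp_emptyPFun]
    refine F.multiplicity_eq_zero (faceAcyclic_univ_of_orthogonal (F := F)
      (fun p hp => sum_parity_mul_eq_zero hk hp) (fun s => ?_) (i + 1))
    rw [mem_canonicalSuboplex_union_singleton, mem_canonicalSuboplex_polythr_iff]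
  · have h1 := hone F
    have : IsEmpty (Fin (F.rank (∑ j ∈ Finset.range (k + 1), d.choose j))) := by
      rw [h0]; infer_instance
    rw [MinimalGradedFreeResolution.multiplicity, Nat.card_of_isEmpty] at h1
    exact zero_ne_one h1
  · by_contra hlt
    rw [not_le, ← finrank_polyFunctions] at hlt
    have b : Fin (F.rank i) := ⟨0, Nat.pos_of_ne_zero hi⟩
    have h0 : Nat.card {c : Fin (F.rank i) // F.deg i c = F.deg i b} = 0 :=
      multiplicity_eq_zero_of_finrank_lt F
        (fun s => mem_canonicalSuboplex_polythr_iff) hlt (F.deg i b)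
    rw [Nat.card_eq_zero] at h0
    rcases h0 with h0 | h0
    · exact h0.false ⟨b, rfl⟩
    · exact h0.not_finite inferInstance

end Main

end
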